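/- **Setting.** Let $N\ge 1$, $m\ge 0$, $b\in\mathbb R^m$ and, for $i=1,\dots,N$, let $A_i\in\mathbb R^{m\times d_i}$ and let $h_i:\mathbb R^{d_i}\to(-\infty,+\infty]$ be proper, convex and lower semicontinuous with compact domain $X_i=\operatorname{dom}h_i$. The primal problem is $$\min\ \frac1N\sum_{i=1}^N h_i(x_i)\quad\text{s.t.}\quad \frac1N\sum_{i=1}^N A_ix_i\le b,\quad x_i\in X_i,$$ and the dual function is $d(\lambda)=-\lambda^\top b+\frac1N\sum_{i}\inf_{x_i\in X_i}\{h_i(x_i)+\lambda^\top A_ix_i\}$. Assume that $d$ has a maximizer $\lambda^*$ over $\mathbb R^m_+$ and that strong duality holds: $d^*:=d(\lambda^*)$ is the optimal value of the primal problem. Write $\|\cdot\|$ for the Euclidean norm, $\|x\|_+=\sqrt{\sum_j\max(x_j,0)^2}$, $[x]_+$ for the coordinatewise positive part, $\tilde G=\sup_{i,\,x_i\in X_i}\|A_ix_i-b\|$ and $H=\sup_{i,\,x_i\in X_i}|h_i(x_i)|$, and assume $H<\infty$. An *oracle* is a map that returns, for each $i$, $\gamma\ge0$ and $\lambda\in\mathbb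 R^m$, a point $x_i^*(\gamma,\lambda)\in\operatorname{argmin}_{x_i\in X_i}\{\gamma h_i(x_i)+\lambda^\top A_ix_i\}$. **Two-stage algorithm**, with parameters $\Lambda>0$, $T\ge1$ and $K$. All indices are drawn independently and uniformly from $\{1,\dots,N\}$. *Stage 1.* Let $\lambda_0=0$ and $\alpha=\Lambda/(\tilde G\sqrt T)$ (if $\tilde G=0$, the value of $\alpha$ is irrelevant). For $t=0,\dots,T-2$ draw $i_t$, call the oracle for $x^{(t)}=x^*_{i_t}(1,\lambda_t)$ and set $\lambda_{t+1}=[\lambda_t+\alpha(A_{i_t}x^{(t)}-b)]_+$. Then call the oracle for $x_i^*(1,\lambda_{T-1})$ for all $i$. Let $I_i=\#\{t\le T-2: i_t=i\}$ and $$\bar\lambda_T=\frac1T\sum_{t=0}^{T-1}\lambda_t,\qquad \bar x_{i,T}=\frac1{I_i+1}\Big(x_i^*(1,\lambda_{T-1})+\sum_{t\le T-2,\ i_t=i}x^{(t)}\Big).$$ *Stage 2 (block-coordinate Frank–Wolfe).* Start from $\hat x^0_i=\bar x_{i,T}$, $\beta_i^0=\frac1Nh_i(\hat x_i^0)$ and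 $z_i^0=\frac1NA_i\hat x_i^0$. For $k=0,\dots,K-1$ put $\gamma^k=\max(\sum_i\beta^k_i-d(\bar\lambda_T),0)$, $g^k=[\sum_iz_i^k-b]_+$ and $\rho_k=\frac{2N}{k+2N}$, draw $i=i_k$, call the oracle for $x=x_i^*(\gamma^k,g^k)$, and set $$\beta_i^{k+1}=(1-\rho_k)\beta_i^k+\tfrac{\rho_k}{N}h_i(x),\quad z_i^{k+1}=(1-\rho_k)z_i^k+\tfrac{\rho_k}{N}A_ix,\quad \hat x_i^{k+1}=(1-\rho_k)\hat x_i^k+\rho_kx,$$ leaving the other blocks unchanged. The output is $\hat x^K$. **Theorem.** For every $\varepsilon_0>0$ there is a constant $C>0$, depending only on $\varepsilon_0$, $\Lambda$ and upper bounds on $\tilde G$, $H$ and $\|\lambda^*\|$ (not on $N$, $m$, the dimensions $d_i$, the problem, the oracle or $\varepsilon$), such that for all $N\ge1$ and $0<\varepsilon\le\varepsilon_0$ there is an integer $T_0\ge1$, depending only on $N$, $\varepsilon$ and the same quantities as $C$, with the following properties. 1. For every $T\ge T_0$, the output $\hat x=\hat x^K$ of the two-stage algorithm with $K=T$ is an $\varepsilon$-accurate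 primal solution in expectation: $\hat x_i\in X_i$ for all $i$, and $$\mathbb E\Big[\frac1N\sum_{i=1}^Nh_i(\hat x_i)\Big]\le d^*+\varepsilon,\qquad \mathbb E\Big\|\frac1N\sum_{i=1}^NA_i\hat x_i-b\Big\|_+\le\varepsilon.$$ 2. With $T=K=T_0$, the total number of oracle calls (including $N$ calls for evaluating $d(\bar\lambda_T)$) is at most $$C\left(\frac1{\varepsilon^2}+\frac N{\varepsilon^{2/3}}\right).$$ -/

import Mathlib

open scoped BigOperators

noncomputable section

/-- Euclidean space `ℝⁿ`. -/
abbrev Vec (n : ℕ) : Type := EuclideanSpace ℝ (Fin n)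

/-- The projection onto the nonnegative orthant, coordinatewise `max (x j) 0`. -/
def projPos {m : ℕ} (x : Vec m) : Vec m := WithLp.toLp 2 fun j => max (x j) 0

/-- `‖x‖₊ = √(∑ⱼ max(xⱼ, 0)²)`. -/
def normPos {m : ℕ} (x : Vec m) : ℝ := √(∑ j, (max (x j) 0) ^ 2)

/-- A separable convex problem with `N` blocks and `m` coupling constraints:
minimize `(1/N) ∑ hᵢ(xᵢ)` subject to `(1/N) ∑ Aᵢ xᵢ ≤ b` and `xᵢ ∈ Xᵢ = dom hᵢ`, where each
`hᵢ : ℝ^{dᵢ} → (-∞, +∞]` is proper, convex and lower semicontinuous with compact domain. -/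
structure SeparableProblem (N m : ℕ) where
  dim : Fin N → ℕ
  h : (i : Fin N) → Vec (dim i) → EReal
  A : (i : Fin N) → Matrix (Fin m) (Fin (dim i)) ℝ
  b : Vec m
  ne_bot : ∀ i x, h i x ≠ ⊥
  dom_nonempty : ∀ i, {x | h i x < ⊤}.Nonempty
  convex_epigraph : ∀ i, Convex ℝ {p : Vec (dim i) × ℝ | h i p.1 ≤ (p.2 : EReal)}
  lsc : ∀ i, LowerSemicontinuous (h i)
  compact_dom : ∀ i, IsCompact {x | h i x < ⊤}

namespace SeparableProblem

variable {N m : ℕ} (P : SeparableProblem N m)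

/-- The domain `Xᵢ` of `hᵢ`. -/
def X (i : Fin N) : Set (Vec (P.dim i)) := {x | P.h i x < ⊤}

/-- The real value of `hᵢ`; only used at points of `Xᵢ`, where `hᵢ` is finite. -/
def hval (i : Fin N) (x : Vec (P.dim i)) : ℝ := (P.h i x).toReal

/-- The product `Aᵢ x`. -/
def mulA (i : Fin N) (x : Vec (P.dim i)) : Vec m := WithLp.toLp 2 ((P.A i).mulVec x.ofLp)

/-- A choice of one vector for each block. -/
abbrev Point : Type := (i : Fin N) → Vec (P.dim i)

/-- The objective `(1/N) ∑ hᵢ(xᵢ)`. -/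
def objective (x : P.Point) : ℝ := (1 / (N : ℝ)) * ∑ i, P.hval i (x i)

/-- The residual `(1/N) ∑ Aᵢ xᵢ - b`. -/
def residual (x : P.Point) : Vec m := (1 / (N : ℝ)) • ∑ i, P.mulA i (x i) - P.b

/-- Feasibility for the primal problem. -/
def Feasible (x : P.Point) : Prop := (∀ i, x i ∈ P.X i) ∧ ∀ j, P.residual x j ≤ 0

/-- The dual function `d(μ) = -μᵀb + (1/N) ∑ inf_{x ∈ Xᵢ} (hᵢ(x) + μᵀAᵢx)`. -/
def dual (μ : Vec m) : ℝ :=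
  -inner ℝ μ P.b + (1 / (N : ℝ)) * ∑ i, ⨅ x : P.X i, (P.hval i x + inner ℝ μ (P.mulA i x))

/-- `μ` maximizes the dual function over the nonnegative orthant. -/
def IsDualMaximizer (μ : Vec m) : Prop :=
  (∀ j, 0 ≤ μ j) ∧ ∀ ν : Vec m, (∀ j, 0 ≤ ν j) → P.dual ν ≤ P.dual μ

/-- The real number `v` is the optimal value of the primal problem. (The empty set of reals has
no greatest lower bound, so this includes feasibility of the problem.) -/
def IsPrimalValue (v : ℝ) : Prop := IsGLB {r | ∃ x, P.Feasible x ∧ r = P.objective x} v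

/-- `G̃ = sup_{i, x ∈ Xᵢ} ‖Aᵢ x - b‖`. -/
def Gtilde : ℝ := sSup {r | ∃ i, ∃ x ∈ P.X i, r = ‖P.mulA i x - P.b‖}

/-- The type of minimization oracles: block, weight `γ` and multiplier to a point of the block. -/
abbrev Oracle : Type := (i : Fin N) → ℝ → Vec m → Vec (P.dim i)

/-- For `γ ≥ 0` the oracle returns some element of `argmin_{x ∈ Xᵢ} (γ hᵢ(x) + μᵀAᵢx)`. -/
def IsArgminOracle (O : P.Oracle) : Prop :=
  ∀ (i : Fin N) (γ : ℝ), 0 ≤ γ → ∀ μ : Vec m,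
    O i γ μ ∈ P.X i ∧
      IsMinOn (fun x => γ * P.hval i x + inner ℝ μ (P.mulA i x)) (P.X i) (O i γ μ)

/-! ### Stage 1: stochastic dual subgradient -/

/-- State of the first stage before iteration `t`. -/
structure State1 where
  /-- the current dual iterate `λ_t` -/
  lam : Vec m
  /-- the sum of `λ_s` over `s < t` -/
  lamSum : Vec m
  /-- the sum of the oracle outputs computed so far for each block -/
  xSum : P.Point
  /-- the number of times each block has been sampled -/
  count : Fin N → ℕ
  /-- the number of oracle calls made so far -/
  calls : ℕ

/-- One stochastic iteration with step size `a` and sampled block `i`. -/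
def step1 (O : P.Oracle) (a : ℝ) (s : P.State1) (i : Fin N) : P.State1 :=
  let x := O i 1 s.lam
  { lam := projPos (s.lam + a • (P.mulA i x - P.b))
    lamSum := s.lamSum + s.lam
    xSum := Function.update s.xSum i (s.xSum i + x)
    count := Function.update s.count i (s.count i + 1)
    calls := s.calls + 1 }

/-- The first `n` stochastic iterations, with sampled blocks `ω 0, …, ω (n - 1)`. -/
def run1 (O : P.Oracle) (lam0 : Vec m) (α : ℕ → ℝ) : (n : ℕ) → (Fin n → Fin N) → P.State1
  | 0, _ => { lam := lam0, lamSum := 0, xSum := fun _ => 0, count := fun _ => 0, calls := 0 }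
  | n + 1, ω => P.step1 O (α n) (run1 O lam0 α n (Fin.init ω)) (ω (Fin.last n))

/-- Output of the first stage. -/
structure Output1 where
  lamBar : Vec m
  xBar : P.Point
  calls : ℕ

/-- The first stage with `T ≥ 1` iterations: `T - 1` stochastic iterations, then a last step in
which the oracle is called at `λ_{T-1}` for all `N` blocks. The returned dual candidate is the
average of `λ_0, …, λ_{T-1}`, and the returned primal candidate averages, block by block, the
oracle outputs. (The dual iterate `λ_T` does not enter the output.) -/
def stage1 (O : P.Oracle) (lam0 : Vec m) (α : ℕ → ℝ) (T : ℕ) (ω : Fin (T - 1) → Fin N) :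
    P.Output1 :=
  let s := P.run1 O lam0 α (T - 1) ω
  { lamBar := (1 / (T : ℝ)) • (s.lamSum + s.lam)
    xBar := fun i => (1 / ((s.count i : ℝ) + 1)) • (s.xSum i + O i 1 s.lam)
    calls := s.calls + N }

/-! ### Stage 2: block-coordinate Frank–Wolfe -/

/-- State of the second stage. -/
structure State2 where
  β : Fin N → ℝ
  z : Fin N → Vec m
  xHat : P.Point
  /-- the number of oracle calls made so far -/
  calls : ℕ

/-- One iteration with target value `v`, step size `r` and sampled block `i`. -/
def step2 (O : P.Oracle) (v r : ℝ) (s : P.State2) (i : Fin N) : P.State2 :=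
  let γ := max (∑ j, s.β j - v) 0
  let g := projPos (∑ j, s.z j - P.b)
  let x := O i γ g
  { β := Function.update s.β i ((1 - r) * s.β i + r * ((1 / (N : ℝ)) * P.hval i x))
    z := Function.update s.z i ((1 - r) • s.z i + r • ((1 / (N : ℝ)) • P.mulA i x))
    xHat := Function.update s.xHat i ((1 - r) • s.xHat i + r • x)
    calls := s.calls + 1 }

/-- The first `k` iterations from the starting point `x0`, with sampled blocks
`ω 0, …, ω (k - 1)` and step sizes `ρ 0, …, ρ (k - 1)`. -/
def run2 (O : P.Oracle) (v : ℝ) (x0 : P.Point) (ρ : ℕ → ℝ) :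
    (k : ℕ) → (Fin k → Fin N) → P.State2
  | 0, _ =>
    { β := fun i => (1 / (N : ℝ)) * P.hval i (x0 i)
      z := fun i => (1 / (N : ℝ)) • P.mulA i (x0 i)
      xHat := x0
      calls := 0 }
  | k + 1, ω => P.step2 O v (ρ k) (run2 O v x0 ρ k (Fin.init ω)) (ω (Fin.last k))

/-! ### The two-stage algorithm -/

/-- The samples drawn by the two-stage algorithm. All sampled blocks are independent and uniform
on `{1, …, N}`, so that their law is the uniform distribution on this finite set. -/
abbrev Samples (N T K : ℕ) : Type := (Fin (T - 1) → Fin N) × (Fin K → Fin N)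

/-- The output `x̂` of the two-stage algorithm, and the total number of oracle calls. -/
structure Output where
  xHat : P.Point
  calls : ℕ

/-- The two-stage algorithm: run the first stage, then run the second stage with target value
`d(λ̄_T)` from the starting point `x̄_T`. Besides the calls made by the two stages, the `N` calls
that evaluate `d(λ̄_T)` are counted too. -/
def twoStage (O : P.Oracle) (lam0 : Vec m) (α ρ : ℕ → ℝ) (T K : ℕ) (ω : Samples N T K) :
    P.Output :=
  let o := P.stage1 O lam0 α T ω.1
  let s := P.run2 O (P.dual o.lamBar) o.xBar ρ K ω.2
  { xHat := s.xHat
    calls := o.calls + N + s.calls }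

/-- The two-stage algorithm with its standard parameters: `λ₀ = 0`, constant step size
`α = Λ / (G̃ √T)` in the first stage and `ρ_k = 2N / (k + 2N)` in the second one. (If `G̃ = 0`,
all stochastic subgradients vanish and the value of `α` is irrelevant.) -/
def standardTwoStage (O : P.Oracle) (Λ : ℝ) (T K : ℕ) (ω : Samples N T K) : P.Output :=
  P.twoStage O 0 (fun _ => Λ / (P.Gtilde * √(T : ℝ)))
    (fun k => 2 * (N : ℝ) / ((k : ℝ) + 2 * (N : ℝ))) T K ω

/-- A random point `x`, defined on a finite sample space with the uniform distribution, is an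
`ε`-accurate primal solution in expectation, where `dstar` is the optimal dual value. -/
def AccurateInExpectation {Ω : Type} [Fintype Ω] (dstar ε : ℝ) (x : Ω → P.Point) : Prop :=
  (∀ ω i, x ω i ∈ P.X i) ∧
    (Finset.univ.expect fun ω => P.objective (x ω)) ≤ dstar + ε ∧
    (Finset.univ.expect fun ω => normPos (P.residual (x ω))) ≤ ε

end SeparableProblem

end

/-!
The first stage is a stochastic subgradient method for the dual problem, and the second one a
block-coordinate Frank–Wolfe method which minimizes the squared distance (`potential`) of the pair
(objective value, residual) to the orthant `(-∞, v] × (-∞, 0]^m`, where `v = d(λ̄_T)`. Write `T`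
for the common number of iterations.

The second stage turns the accuracy of its start into a better one. A nearly optimal feasible
point has potential at most about `(d* - v)²`, and convexity and smoothness give a contraction of
the expected potential towards this value by the factor `1 - 2 / (k + 2N)` in step `k`, up to an
error of order `1 / (k + 2N)²` (`expect_potential_step2_le`). These inequalities telescope after
multiplication by `(k + 2N - 1)²`, so that the initial potential `F₀` is damped by `(N / T)²` and
the other errors sum up to `O(1 / T)`. Hence, given the first stage, the square root of the final
potential is in expectation at most `(d* - v) + (2N / T) √F₀ + O(1 / √T)`
(`expect_sqrt_potential_run2_le`), and only first moments of the output of the first stage matter.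

For the first stage, the expansion of `‖λ_{t+1} - λ*‖²` gives `𝔼 (d* - v) = O(1 / √T)` and bounds
the second moments of the multipliers (`expect_dual_gap_le`, `expect_norm_lam_sub_sq_le`). The
average of all sampled blocks has a residual with positive part bounded by `‖λ_{T-1}‖ / (α T)`,
and its objective value exceeds `v` by `O(1 / √T)` in expectation, since the sampled dual values
deviate from `d(λ_t)` by a martingale (`expect_dualDev_sq_le`). The algorithm averages within each
block instead. This is the same up to the deviation of the sampling frequencies from `1 / N`
(`norm_blockAverage_sub_le`), which sum up to `O(√(N / T))` by a variance computation
(`expect_freqDev_le`). Therefore `𝔼 √F₀ = O(√(N / T))`.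

Altogether the expected error is `O(1 / √T + (N / T)^{3/2})`, which is at most `ε` as soon as `T`
is a suitable multiple of `1 / ε² + N / ε^{2/3}`.
-/

/-! ### Averages over finite sample spaces -/

/-- The last sample can be averaged out first: it is independent of the earlier ones. -/
theorem expect_fin_succ {α : Type*} [Fintype α] {n : ℕ} (F : (Fin n → α) → α → ℝ) :
    (𝔼 ω : Fin (n + 1) → α, F (Fin.init ω) (ω (Fin.last n))) =
      𝔼 ω : Fin n → α, 𝔼 i, F ω i := by
  rw [Finset.expect_comm, ← Finset.expect_product']
  symm
  refine Fintype.expect_equiv (Fin.snocEquiv fun _ => α) _ _ ?_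
  rintro ⟨i, ω⟩
  simp [Fin.snocEquiv]

/-- Jensen's inequality for the square, in the form used to pass from second to first moments. -/
theorem expect_le_of_expect_sq_le {Ω : Type*} [Fintype Ω] [Nonempty Ω] {f : Ω → ℝ} {B : ℝ}
    (hB : 0 ≤ B) (h : (𝔼 ω, f ω ^ 2) ≤ B ^ 2) : (𝔼 ω, f ω) ≤ B := by
  refine le_of_sq_le_sq ?_ hB
  have := Finset.expect_mul_sq_le_sq_mul_sq Finset.univ f fun _ => 1
  simp only [mul_one, one_pow, Fintype.expect_const] at this
  exact this.trans h

theorem expect_sub_sq {α : Type*} [Fintype α] [Nonempty α] (f : α → ℝ) :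
    (𝔼 i, (f i - 𝔼 j, f j) ^ 2) = (𝔼 i, f i ^ 2) - (𝔼 j, f j) ^ 2 := by
  set c := 𝔼 j, f j with hc
  have : ∀ i, (f i - c) ^ 2 = f i ^ 2 - 2 * c * f i + c ^ 2 := fun i => by ring
  simp only [this, Finset.expect_add_distrib, Finset.expect_sub_distrib, ← Finset.mul_expect,
    Fintype.expect_const, ← hc]
  ring

theorem expect_fin_eq {N : ℕ} (f : Fin N → ℝ) : (𝔼 i, f i) = (1 / (N : ℝ)) * ∑ i, f i := by
  rw [Fintype.expect_eq_sum_div_card, Fintype.card_fin]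
  ring

/-! ### The positive part of a vector -/

theorem norm_le_norm_of_sq_le {m : ℕ} {x y : Vec m} (h : ∀ j, x j ^ 2 ≤ y j ^ 2) : ‖x‖ ≤ ‖y‖ := by
  rw [EuclideanSpace.norm_eq, EuclideanSpace.norm_eq]
  refine Real.sqrt_le_sqrt (Finset.sum_le_sum fun j _ => ?_)
  simpa using h j

@[simp] theorem projPos_apply {m : ℕ} (x : Vec m) (j : Fin m) : projPos x j = max (x j) 0 := rfl

theorem normPos_eq_norm_projPos {m : ℕ} (x : Vec m) : normPos x = ‖projPos x‖ := by
  simp [normPos, EuclideanSpace.norm_eq]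

theorem normPos_nonneg {m : ℕ} (x : Vec m) : 0 ≤ normPos x := Real.sqrt_nonneg _

theorem max_add_sq_le (a b : ℝ) : max (a + b) 0 ^ 2 ≤ (max a 0 + b) ^ 2 := by
  rcases le_total (a + b) 0 with h | h
  · rw [max_eq_right h]
    simpa using sq_nonneg _
  · rw [max_eq_left h]
    exact pow_le_pow_left₀ h (by gcongr; exact le_max_left _ _) 2

theorem norm_projPos_add_le {m : ℕ} (x w : Vec m) : ‖projPos (x + w)‖ ≤ ‖projPos x + w‖ :=
  norm_le_norm_of_sq_le fun j => by simpa using max_add_sq_le (x j) (w j)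

theorem normPos_add_le {m : ℕ} (x w : Vec m) : normPos (x + w) ≤ normPos x + ‖w‖ := by
  rw [normPos_eq_norm_projPos, normPos_eq_norm_projPos]
  exact (norm_projPos_add_le x w).trans (norm_add_le _ _)

/-- The projection onto the orthant does not increase the distance to points of the orthant. -/
theorem norm_projPos_sub_le {m : ℕ} (x ν : Vec m) (hν : ∀ j, 0 ≤ ν j) :
    ‖projPos x - ν‖ ≤ ‖x - ν‖ := by
  refine norm_le_norm_of_sq_le fun j => ?_
  simp only [PiLp.sub_apply, projPos_apply]
  have := hν j
  rcases le_total (x j) 0 with h | h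
  · rw [max_eq_right h]; nlinarith
  · rw [max_eq_left h]

theorem inner_projPos_self {m : ℕ} (x : Vec m) : inner ℝ (projPos x) x = ‖projPos x‖ ^ 2 := by
  rw [← real_inner_self_eq_norm_sq, PiLp.inner_apply, PiLp.inner_apply]
  refine Finset.sum_congr rfl fun j _ => ?_
  rcases le_total (x j) 0 with h | h <;> simp [h]

theorem inner_nonpos_of_le {m : ℕ} {x y : Vec m} (hx : ∀ j, 0 ≤ x j) (hy : ∀ j, y j ≤ 0) :
    inner ℝ x y ≤ 0 := by
  rw [PiLp.inner_apply]
  refine Finset.sum_nonpos fun j _ => ?_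
  simpa [mul_comm] using mul_nonpos_of_nonneg_of_nonpos (hx j) (hy j)

theorem normPos_le_norm_of_le {m : ℕ} {x y : Vec m} (h : ∀ j, x j ≤ y j) : normPos x ≤ ‖y‖ := by
  rw [normPos_eq_norm_projPos]
  refine norm_le_norm_of_sq_le fun j => ?_
  rw [projPos_apply, ← sq_abs (y j)]
  exact pow_le_pow_left₀ (le_max_right _ _)
    (max_le ((h j).trans (le_abs_self _)) (abs_nonneg _)) 2

theorem normPos_smul {m : ℕ} {c : ℝ} (hc : 0 ≤ c) (x : Vec m) :
    normPos (c • x) = c * normPos x := by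
  have : projPos (c • x) = c • projPos x := by
    ext j
    simp [mul_max_of_nonneg _ _ hc]
  rw [normPos_eq_norm_projPos, normPos_eq_norm_projPos, this, norm_smul, Real.norm_of_nonneg hc]

namespace SeparableProblem

variable {N m : ℕ} (P : SeparableProblem N m)

/-! ### Blocks, oracle and dual function -/

theorem coe_hval {i : Fin N} {x : Vec (P.dim i)} (hx : x ∈ P.X i) :
    (P.hval i x : EReal) = P.h i x :=
  EReal.coe_toReal (ne_of_lt hx) (P.ne_bot i x)

theorem hval_convex {i : Fin N} {x y : Vec (P.dim i)} (hx : x ∈ P.X i) (hy : y ∈ P.X i)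
    {a c : ℝ} (ha : 0 ≤ a) (hc : 0 ≤ c) (hac : a + c = 1) :
    a • x + c • y ∈ P.X i ∧ P.hval i (a • x + c • y) ≤ a * P.hval i x + c * P.hval i y := by
  have hx' : (x, P.hval i x) ∈ {p : Vec (P.dim i) × ℝ | P.h i p.1 ≤ (p.2 : EReal)} :=
    (P.coe_hval hx).ge
  have hy' : (y, P.hval i y) ∈ {p : Vec (P.dim i) × ℝ | P.h i p.1 ≤ (p.2 : EReal)} :=
    (P.coe_hval hy).ge
  have key : P.h i (a • x + c • y) ≤ ((a * P.hval i x + c * P.hval i y : ℝ) : EReal) :=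
    P.convex_epigraph i hx' hy' ha hc hac
  have hmem : a • x + c • y ∈ P.X i := lt_of_le_of_lt key (EReal.coe_lt_top _)
  refine ⟨hmem, ?_⟩
  rw [← P.coe_hval hmem] at key
  exact_mod_cast key

@[simp] theorem mulA_add (i : Fin N) (x y : Vec (P.dim i)) :
    P.mulA i (x + y) = P.mulA i x + P.mulA i y := by
  ext j; simp [mulA, Matrix.mulVec_add]

@[simp] theorem mulA_smul (i : Fin N) (c : ℝ) (x : Vec (P.dim i)) :
    P.mulA i (c • x) = c • P.mulA i x := by
  ext j; simp [mulA, Matrix.mulVec_smul]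

@[simp] theorem mulA_zero (i : Fin N) : P.mulA i 0 = 0 := by
  ext j; simp [mulA]

theorem continuous_mulA (i : Fin N) : Continuous (P.mulA i) := by
  unfold mulA
  fun_prop

theorem isCompact_X (i : Fin N) : IsCompact (P.X i) := P.compact_dom i

/-- The supremum defining `G̃` is one of a bounded set, because the blocks are compact. -/
theorem norm_mulA_sub_le_Gtilde (i : Fin N) {x : Vec (P.dim i)} (hx : x ∈ P.X i) :
    ‖P.mulA i x - P.b‖ ≤ P.Gtilde := by
  refine le_csSup ?_ ⟨i, x, hx, rfl⟩
  have hb : ∀ i, ∃ c, ∀ x ∈ P.X i, ‖P.mulA i x - P.b‖ ≤ c := fun i =>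
    (P.isCompact_X i).exists_bound_of_continuousOn
      (((P.continuous_mulA i).sub continuous_const).continuousOn)
  choose c hc using hb
  refine ⟨∑ i, |c i|, ?_⟩
  rintro r ⟨i, x, hx, rfl⟩
  exact ((hc i x hx).trans (le_abs_self _)).trans
    (Finset.single_le_sum (f := fun i => |c i|) (fun i _ => abs_nonneg _) (Finset.mem_univ i))

variable {P} {O : P.Oracle}

theorem IsArgminOracle.mem (hO : P.IsArgminOracle O) (i : Fin N) {γ : ℝ} (hγ : 0 ≤ γ) (μ : Vec m) :
    O i γ μ ∈ P.X i := (hO i γ hγ μ).1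

theorem IsArgminOracle.le (hO : P.IsArgminOracle O) (i : Fin N) {γ : ℝ} (hγ : 0 ≤ γ) (μ : Vec m)
    {x : Vec (P.dim i)} (hx : x ∈ P.X i) :
    γ * P.hval i (O i γ μ) + inner ℝ μ (P.mulA i (O i γ μ)) ≤
      γ * P.hval i x + inner ℝ μ (P.mulA i x) := (hO i γ hγ μ).2 hx

variable (P) in
/-- The stochastic dual value `hᵢ(x) + μᵀ(Aᵢx - b)` at the oracle point of block `i`. -/
noncomputable def blockDual (O : P.Oracle) (μ : Vec m) (i : Fin N) : ℝ :=
  P.hval i (O i 1 μ) + inner ℝ μ (P.mulA i (O i 1 μ) - P.b)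

theorem IsArgminOracle.blockDual_le (hO : P.IsArgminOracle O) (μ : Vec m) (i : Fin N)
    {x : Vec (P.dim i)} (hx : x ∈ P.X i) :
    P.blockDual O μ i ≤ P.hval i x + inner ℝ μ (P.mulA i x - P.b) := by
  have := hO.le i zero_le_one μ hx
  simp only [blockDual, inner_sub_right]
  linarith

theorem expect_lagrangian [NeZero N] (μ : Vec m) (x : P.Point) :
    (𝔼 i, (P.hval i (x i) + inner ℝ μ (P.mulA i (x i) - P.b))) =
      P.objective x + inner ℝ μ (P.residual x) := by
  simp only [inner_sub_right, add_sub_assoc', Finset.expect_sub_distrib, Fintype.expect_const]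
  rw [expect_fin_eq, objective, residual, inner_sub_right, inner_smul_right, inner_sum,
    Finset.sum_add_distrib]
  ring

/-- The stochastic dual value is an unbiased estimate of the dual function. -/
theorem IsArgminOracle.expect_blockDual [NeZero N] (hO : P.IsArgminOracle O) (μ : Vec m) :
    (𝔼 i, P.blockDual O μ i) = P.dual μ := by
  have hinf : ∀ i, (⨅ x : P.X i, (P.hval i x + inner ℝ μ (P.mulA i x))) =
      P.hval i (O i 1 μ) + inner ℝ μ (P.mulA i (O i 1 μ)) := fun i => by
    have hmin : ∀ x : P.X i, P.hval i (O i 1 μ) + inner ℝ μ (P.mulA i (O i 1 μ)) ≤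
        P.hval i x + inner ℝ μ (P.mulA i x) := fun x => by
      simpa using hO.le i zero_le_one μ x.2
    have : Nonempty (P.X i) := ⟨⟨_, hO.mem i zero_le_one μ⟩⟩
    refine le_antisymm ?_ (le_ciInf hmin)
    exact ciInf_le ⟨_, Set.forall_mem_range.2 hmin⟩ (⟨_, hO.mem i zero_le_one μ⟩ : P.X i)
  rw [dual]
  simp only [hinf, ← expect_fin_eq, blockDual, inner_sub_right, add_sub_assoc',
    Finset.expect_sub_distrib, Fintype.expect_const]
  ring

/-- Weak duality: every Lagrangian value over the blocks bounds the dual function. -/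
theorem IsArgminOracle.dual_le [NeZero N] (hO : P.IsArgminOracle O) (μ : Vec m) {x : P.Point}
    (hx : ∀ i, x i ∈ P.X i) : P.dual μ ≤ P.objective x + inner ℝ μ (P.residual x) := by
  rw [← hO.expect_blockDual, ← expect_lagrangian]
  exact Finset.expect_le_expect fun i _ => hO.blockDual_le μ i (hx i)

theorem IsArgminOracle.dual_eq [NeZero N] (hO : P.IsArgminOracle O) (μ : Vec m) :
    P.dual μ = P.objective (fun i => O i 1 μ) + inner ℝ μ (P.residual fun i => O i 1 μ) := by
  rw [← hO.expect_blockDual, ← expect_lagrangian]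
  rfl

/-- The stochastic subgradient is unbiased, and its mean is a supergradient of the concave
dual function. -/
theorem IsArgminOracle.dual_sub_le [NeZero N] (hO : P.IsArgminOracle O) (μ ν : Vec m) :
    P.dual ν - P.dual μ ≤ 𝔼 i, inner ℝ (ν - μ) (P.mulA i (O i 1 μ) - P.b) := by
  rw [← hO.expect_blockDual μ, ← hO.expect_blockDual ν, ← Finset.expect_sub_distrib]
  refine Finset.expect_le_expect fun i _ => ?_
  have := hO.blockDual_le ν i (hO.mem i zero_le_one μ)
  rw [inner_sub_left]
  unfold blockDual at *
  linarith

/-! ### Block-coordinate Frank–Wolfe -/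

theorem sum_update_eq {ι E : Type*} [Fintype ι] [DecidableEq ι] [AddCommGroup E] (f : ι → E)
    (i : ι) (w : E) : ∑ j, Function.update f i w j = ∑ j, f j + (w - f i) := by
  rw [Finset.sum_update_of_mem (Finset.mem_univ i), ← Finset.add_sum_erase _ f (Finset.mem_univ i),
    Finset.sdiff_singleton_eq_erase]
  abel

/-- Twice the function that the second stage minimizes: the squared distance of the pair
(objective value, residual) to the orthant `(-∞, v] × (-∞, 0]^m`. -/
noncomputable def potential (v : ℝ) (s : P.State2) : ℝ :=
  max (∑ j, s.β j - v) 0 ^ 2 + ‖projPos (∑ j, s.z j - P.b)‖ ^ 2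

theorem potential_nonneg (v : ℝ) (s : P.State2) : 0 ≤ potential v s := by
  unfold potential
  positivity

/-- The invariant of the second stage: `x̂` stays in the blocks and, up to the factor `1/N`, `z`
holds the values `Aᵢ x̂ᵢ` and `β` holds upper bounds of the values `hᵢ(x̂ᵢ)`. The latter need not be
equal to them, since `hᵢ` is only convex. -/
structure Valid2 (H : ℝ) (s : P.State2) : Prop where
  mem : ∀ i, s.xHat i ∈ P.X i
  hval_le : ∀ i, (1 / (N : ℝ)) * P.hval i (s.xHat i) ≤ s.β i
  z_eq : ∀ i, s.z i = (1 / (N : ℝ)) • P.mulA i (s.xHat i)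
  abs_le : ∀ i, |s.β i| ≤ 1 / (N : ℝ) * H

theorem abs_convex_comb_le {a b c r : ℝ} (h0 : 0 ≤ r) (h1 : r ≤ 1) (ha : |a| ≤ c) (hb : |b| ≤ c) :
    |(1 - r) * a + r * b| ≤ c := by
  rw [abs_le] at *
  constructor <;> nlinarith

theorem valid2_step2 {H v r : ℝ} (hO : P.IsArgminOracle O)
    (hH : ∀ i, ∀ x ∈ P.X i, |P.hval i x| ≤ H) (h0 : 0 ≤ r) (h1 : r ≤ 1) {s : P.State2}
    (hs : Valid2 H s) (i : Fin N) : Valid2 H (P.step2 O v r s i) := by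
  have hx := hO.mem i (le_max_right (∑ j, s.β j - v) 0) (projPos (∑ j, s.z j - P.b))
  have hconv := P.hval_convex (hs.mem i) hx (sub_nonneg.2 h1) h0 (by ring)
  have hN : (0 : ℝ) ≤ 1 / (N : ℝ) := by positivity
  constructor <;> intro j <;> by_cases hj : j = i
  · subst hj; simpa [step2] using hconv.1
  · simpa [step2, Function.update_of_ne hj] using hs.mem j
  · subst hj
    simp only [step2, Function.update_self]
    nlinarith [mul_le_mul_of_nonneg_left hconv.2 hN,
      mul_le_mul_of_nonneg_left (hs.hval_le j) (sub_nonneg.2 h1)]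
  · simpa [step2, Function.update_of_ne hj] using hs.hval_le j
  · subst hj
    simp only [step2, Function.update_self, hs.z_eq, mulA_add, mulA_smul]
    module
  · simpa [step2, Function.update_of_ne hj] using hs.z_eq j
  · subst hj
    simp only [step2, Function.update_self]
    refine abs_convex_comb_le h0 h1 (hs.abs_le j) ?_
    rw [abs_mul, abs_of_nonneg hN]
    exact mul_le_mul_of_nonneg_left (hH j _ hx) hN
  · simpa [step2, Function.update_of_ne hj] using hs.abs_le j

/-- The function minimized by the second stage is smooth with constant one. -/
theorem potential_step2_le {H G v r : ℝ} (hO : P.IsArgminOracle O)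
    (hH : ∀ i, ∀ x ∈ P.X i, |P.hval i x| ≤ H) (hG : ∀ i, ∀ x ∈ P.X i, ‖P.mulA i x - P.b‖ ≤ G)
    {s : P.State2} (hs : Valid2 H s) (i : Fin N) :
    let γ := max (∑ j, s.β j - v) 0
    let g := projPos (∑ j, s.z j - P.b)
    potential v (P.step2 O v r s i) ≤ potential v s +
      2 * r * (γ * ((1 / (N : ℝ)) * P.hval i (O i γ g) - s.β i) +
        inner ℝ g ((1 / (N : ℝ)) • P.mulA i (O i γ g) - s.z i)) +
      r ^ 2 * (4 * (H + G) ^ 2 / N ^ 2) := by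
  intro γ g
  have hx : O i γ g ∈ P.X i := hO.mem i (le_max_right _ _) g
  set x := O i γ g with hxdef
  set δ := (1 / (N : ℝ)) * P.hval i x - s.β i with hδ
  set w := (1 / (N : ℝ)) • P.mulA i x - s.z i with hw
  have hN : (0 : ℝ) ≤ 1 / (N : ℝ) := by positivity
  have hH0 : 0 ≤ H := (abs_nonneg _).trans (hH i x hx)
  have hG0 : 0 ≤ G := (norm_nonneg _).trans (hG i x hx)
  have hβ : ∑ j, (P.step2 O v r s i).β j - v = (∑ j, s.β j - v) + r * δ := by
    simp only [step2, sum_update_eq]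
    rw [hδ, hxdef]
    ring
  have hz : ∑ j, (P.step2 O v r s i).z j - P.b = (∑ j, s.z j - P.b) + r • w := by
    simp only [step2, sum_update_eq]
    rw [hw, hxdef]
    module
  have hδle : |δ| ≤ 2 * H / N := by
    have h1 : |(1 / (N : ℝ)) * P.hval i x| ≤ 1 / (N : ℝ) * H := by
      rw [abs_mul, abs_of_nonneg hN]
      exact mul_le_mul_of_nonneg_left (hH i x hx) hN
    calc |δ| ≤ _ := abs_sub _ _
      _ ≤ 1 / (N : ℝ) * H + 1 / (N : ℝ) * H := add_le_add h1 (hs.abs_le i)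
      _ = 2 * H / N := by ring
  have hwle : ‖w‖ ≤ 2 * G / N := by
    have : w = (1 / (N : ℝ)) • ((P.mulA i x - P.b) - (P.mulA i (s.xHat i) - P.b)) := by
      rw [hw, hs.z_eq]
      module
    rw [this, norm_smul, Real.norm_of_nonneg hN]
    calc _ ≤ 1 / (N : ℝ) * (G + G) := by
          gcongr
          exact (norm_sub_le _ _).trans (add_le_add (hG i x hx) (hG i _ (hs.mem i)))
      _ = 2 * G / N := by ring
  have e1 : max (∑ j, s.β j - v + r * δ) 0 ^ 2 ≤ γ ^ 2 + 2 * r * (γ * δ) + r ^ 2 * δ ^ 2 :=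
    (max_add_sq_le _ _).trans_eq (by ring)
  have e2 : ‖projPos (∑ j, s.z j - P.b + r • w)‖ ^ 2 ≤
      ‖g‖ ^ 2 + 2 * r * inner ℝ g w + r ^ 2 * ‖w‖ ^ 2 := by
    refine (pow_le_pow_left₀ (norm_nonneg _) (norm_projPos_add_le _ _) 2).trans_eq ?_
    rw [norm_add_sq_real, inner_smul_right, norm_smul, mul_pow, Real.norm_eq_abs, sq_abs]
    ring
  have e3 : δ ^ 2 + ‖w‖ ^ 2 ≤ 4 * (H + G) ^ 2 / N ^ 2 := by
    have h1 : δ ^ 2 ≤ (2 * H / N) ^ 2 := by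
      rw [← sq_abs]
      exact pow_le_pow_left₀ (abs_nonneg _) hδle 2
    have h2 : ‖w‖ ^ 2 ≤ (2 * G / N) ^ 2 := pow_le_pow_left₀ (norm_nonneg _) hwle 2
    have h3 : (2 * H / N) ^ 2 + (2 * G / N) ^ 2 + 8 * (H * G) / N ^ 2 =
        4 * (H + G) ^ 2 / N ^ 2 := by ring
    have h4 : 0 ≤ 8 * (H * G) / (N : ℝ) ^ 2 := by positivity
    linarith
  unfold potential
  rw [hβ, hz]
  nlinarith [mul_le_mul_of_nonneg_left e3 (sq_nonneg r)]

/-- One Frank–Wolfe step contracts the potential in expectation. The oracle minimizes the linearized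
potential, whose value at a nearly optimal feasible point `y` bounds the progress. -/
theorem expect_potential_step2_le [NeZero N] {H G v r ρ : ℝ} (hO : P.IsArgminOracle O)
    (hH : ∀ i, ∀ x ∈ P.X i, |P.hval i x| ≤ H) (hG : ∀ i, ∀ x ∈ P.X i, ‖P.mulA i x - P.b‖ ≤ G)
    (hρ : 0 ≤ ρ) {y : P.Point} (hy : P.Feasible y) (hyr : P.objective y - v ≤ r)
    {s : P.State2} (hs : Valid2 H s) :
    (𝔼 i, potential v (P.step2 O v ρ s i)) ≤
      (1 - ρ / N) * potential v s + ρ / N * r ^ 2 + ρ ^ 2 * (4 * (H + G) ^ 2 / N ^ 2) := by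
  have h1 := Finset.expect_le_expect (s := Finset.univ)
    fun i _ => potential_step2_le (v := v) (r := ρ) hO hH hG hs i
  refine h1.trans ?_
  rw [Finset.expect_add_distrib, Finset.expect_add_distrib, Fintype.expect_const,
    Fintype.expect_const, ← Finset.mul_expect, expect_fin_eq]
  set γ := max (∑ j, s.β j - v) 0 with hγ
  set g := projPos (∑ j, s.z j - P.b) with hg
  have hγ0 : 0 ≤ γ := le_max_right _ _
  have hN : (0 : ℝ) ≤ 1 / (N : ℝ) := by positivity
  have h2 : ∑ i, (γ * ((1 / (N : ℝ)) * P.hval i (O i γ g) - s.β i) +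
      inner ℝ g ((1 / (N : ℝ)) • P.mulA i (O i γ g) - s.z i)) ≤
      γ * (P.objective y - ∑ j, s.β j) +
        inner ℝ g (P.residual y - (∑ j, s.z j - P.b)) := by
    have : γ * (P.objective y - ∑ j, s.β j) + inner ℝ g (P.residual y - (∑ j, s.z j - P.b)) =
        ∑ i, (γ * ((1 / (N : ℝ)) * P.hval i (y i) - s.β i) +
          inner ℝ g ((1 / (N : ℝ)) • P.mulA i (y i) - s.z i)) := by
      rw [Finset.sum_add_distrib, ← Finset.mul_sum, ← inner_sum, Finset.sum_sub_distrib,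
        Finset.sum_sub_distrib, ← Finset.mul_sum, ← Finset.smul_sum, objective, residual]
      congr 2
      abel
    rw [this]
    refine Finset.sum_le_sum fun i _ => ?_
    have := mul_le_mul_of_nonneg_left (hO.le i hγ0 g (hy.1 i)) hN
    simp only [inner_sub_right, inner_smul_right]
    linarith
  have h3 : γ * (P.objective y - ∑ j, s.β j) + inner ℝ g (P.residual y - (∑ j, s.z j - P.b)) ≤
      (r ^ 2 - potential v s) / 2 := by
    have e1 : γ * (∑ j, s.β j - v) = γ ^ 2 := by
      rcases le_total (∑ j, s.β j - v) 0 with h | h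
      · rw [hγ, max_eq_right h]; ring
      · rw [hγ, max_eq_left h]; ring
    have e2 : inner ℝ g (P.residual y) ≤ 0 := inner_nonpos_of_le (fun j => le_max_right _ _) hy.2
    have e3 : inner ℝ g (∑ j, s.z j - P.b) = ‖g‖ ^ 2 := inner_projPos_self _
    have e4 : potential v s = γ ^ 2 + ‖g‖ ^ 2 := rfl
    rw [inner_sub_right, e3, e4]
    nlinarith [mul_le_mul_of_nonneg_left hyr hγ0, sq_nonneg (γ - r), sq_nonneg ‖g‖]
  have h4 := mul_le_mul_of_nonneg_left (h2.trans h3) (mul_nonneg hρ hN)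
  calc _ = potential v s + 2 * (ρ * (1 / (N : ℝ)) * ∑ i,
          (γ * ((1 / (N : ℝ)) * P.hval i (O i γ g) - s.β i) +
          inner ℝ g ((1 / (N : ℝ)) • P.mulA i (O i γ g) - s.z i))) +
          ρ ^ 2 * (4 * (H + G) ^ 2 / N ^ 2) := by ring
    _ ≤ potential v s + 2 * (ρ * (1 / (N : ℝ)) * ((r ^ 2 - potential v s) / 2)) +
          ρ ^ 2 * (4 * (H + G) ^ 2 / N ^ 2) := by gcongr
    _ = _ := by ring

theorem valid2_run2 {H v : ℝ} {ρ : ℕ → ℝ} (hO : P.IsArgminOracle O)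
    (hH : ∀ i, ∀ x ∈ P.X i, |P.hval i x| ≤ H) (h0 : ∀ k, 0 ≤ ρ k) (h1 : ∀ k, ρ k ≤ 1)
    {x0 : P.Point} (hx0 : ∀ i, x0 i ∈ P.X i) (k : ℕ) (ω : Fin k → Fin N) :
    Valid2 H (P.run2 O v x0 ρ k ω) := by
  induction k with
  | zero =>
    have hN : (0 : ℝ) ≤ 1 / (N : ℝ) := by positivity
    refine ⟨hx0, fun i => le_refl _, fun i => rfl, fun i => ?_⟩
    simp only [run2]
    rw [abs_mul, abs_of_nonneg hN]
    exact mul_le_mul_of_nonneg_left (hH i _ (hx0 i)) hN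
  | succ k ih => exact valid2_step2 hO hH (h0 k) (h1 k) (ih _) _

theorem calls_run2 {v : ℝ} {ρ : ℕ → ℝ} {x0 : P.Point} (k : ℕ) (ω : Fin k → Fin N) :
    (P.run2 O v x0 ρ k ω).calls = k := by
  induction k with
  | zero => rfl
  | succ k ih => simp [run2, step2, ih]

/-- The step size `2N / (k + 2N)` of block-coordinate Frank–Wolfe. -/
noncomputable def fwStep (N k : ℕ) : ℝ := 2 * (N : ℝ) / ((k : ℝ) + 2 * (N : ℝ))

theorem fwStep_nonneg (N k : ℕ) : 0 ≤ fwStep N k := by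
  unfold fwStep
  positivity

theorem fwStep_le_one (N k : ℕ) : fwStep N k ≤ 1 := by
  unfold fwStep
  exact div_le_one_of_le₀ (by linarith [(Nat.cast_nonneg k : (0 : ℝ) ≤ k)]) (by positivity)

/-- Weighted by `(k + 2N - 1)²`, the contractions of all steps telescope. The initial potential is
thus damped by the factor `(N / k)²`, and not only by `N / k`. -/
theorem expect_potential_run2_le [NeZero N] {H G v r : ℝ} (hO : P.IsArgminOracle O)
    (hH : ∀ i, ∀ x ∈ P.X i, |P.hval i x| ≤ H) (hG : ∀ i, ∀ x ∈ P.X i, ‖P.mulA i x - P.b‖ ≤ G)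
    {x0 : P.Point} (hx0 : ∀ i, x0 i ∈ P.X i) {y : P.Point} (hy : P.Feasible y)
    (hyr : P.objective y - v ≤ r) (k : ℕ) :
    ((𝔼 ω, potential v (P.run2 O v x0 (fwStep N) k ω)) - r ^ 2) * (k + 2 * N - 1) ^ 2 ≤
      (2 * N) ^ 2 * potential v (P.run2 O v x0 (fwStep N) 0 Fin.elim0) +
        16 * (H + G) ^ 2 * k := by
  have hN1 : (1 : ℝ) ≤ N := by exact_mod_cast NeZero.one_le (n := N)
  induction k with
  | zero =>
    have h0 : ∀ ω : Fin 0 → Fin N, P.run2 O v x0 (fwStep N) 0 ω =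
        P.run2 O v x0 (fwStep N) 0 Fin.elim0 := fun ω => rfl
    simp only [h0, Fintype.expect_const]
    have := potential_nonneg v (P.run2 O v x0 (fwStep N) 0 Fin.elim0)
    have hsq : ((0 : ℝ) + 2 * N - 1) ^ 2 ≤ (2 * N) ^ 2 := by nlinarith
    push_cast
    nlinarith [mul_le_mul_of_nonneg_left hsq this,
      mul_nonneg (sq_nonneg r) (sq_nonneg ((0 : ℝ) + 2 * N - 1))]
  | succ k ih =>
    set U := (2 * N) ^ 2 * potential v (P.run2 O v x0 (fwStep N) 0 Fin.elim0) +
        16 * (H + G) ^ 2 * k with hU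
    have hU0 : 0 ≤ U := by
      have := potential_nonneg v (P.run2 O v x0 (fwStep N) 0 Fin.elim0)
      positivity
    set e := 𝔼 ω, potential v (P.run2 O v x0 (fwStep N) k ω) with he
    have hk : (0 : ℝ) ≤ k := Nat.cast_nonneg k
    have hstep : (𝔼 ω, potential v (P.run2 O v x0 (fwStep N) (k + 1) ω)) ≤
        (1 - fwStep N k / N) * e + fwStep N k / N * r ^ 2 +
          fwStep N k ^ 2 * (4 * (H + G) ^ 2 / N ^ 2) := by
      simp only [run2]
      rw [expect_fin_succ
        (fun ω i => potential v (P.step2 O v (fwStep N k) (P.run2 O v x0 (fwStep N) k ω) i))]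
      refine (Finset.expect_le_expect fun ω _ => expect_potential_step2_le hO hH hG
        (fwStep_nonneg N k) hy hyr
        (valid2_run2 hO hH (fwStep_nonneg N) (fwStep_le_one N) hx0 k ω)).trans_eq ?_
      simp only [Finset.expect_add_distrib, Fintype.expect_const, ← Finset.mul_expect, ← he]
    set n : ℝ := k + 2 * N with hn
    have hn2 : 2 ≤ n := by linarith
    have hn0 : n ≠ 0 := by linarith
    have hN0 : (N : ℝ) ≠ 0 := by linarith
    have hρ : fwStep N k = 2 * N / n := rfl
    set e' := 𝔼 ω, potential v (P.run2 O v x0 (fwStep N) (k + 1) ω) with he'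
    have h5 : (e' - r ^ 2) * n ^ 2 ≤ n * (n - 2) * (e - r ^ 2) + 16 * (H + G) ^ 2 := by
      have h6 : (1 - fwStep N k / N) * e + fwStep N k / N * r ^ 2 +
          fwStep N k ^ 2 * (4 * (H + G) ^ 2 / N ^ 2) - r ^ 2 =
          (n * (n - 2) * (e - r ^ 2) + 16 * (H + G) ^ 2) / n ^ 2 := by
        rw [hρ]
        field_simp
        ring
      rw [← le_div_iff₀ (by positivity), ← h6]
      linarith
    -- The weights telescope because `n (n - 2) ≤ (n - 1)²`.
    have h7 : n * (n - 2) * (e - r ^ 2) ≤ U := by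
      rcases le_total (e - r ^ 2) 0 with h | h
      · have : 0 ≤ n * (n - 2) := mul_nonneg (by linarith) (by linarith)
        nlinarith
      · nlinarith
    have h8 : ((k + 1 : ℕ) : ℝ) + 2 * N - 1 = n := by push_cast; ring
    rw [h8]
    push_cast
    linarith

/-- The value of the second stage, given the output `(v, x0)` of the first one. -/
theorem expect_sqrt_potential_run2_le [NeZero N] {H G v r : ℝ} (hO : P.IsArgminOracle O)
    (hH : ∀ i, ∀ x ∈ P.X i, |P.hval i x| ≤ H) (hG : ∀ i, ∀ x ∈ P.X i, ‖P.mulA i x - P.b‖ ≤ G)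
    {x0 : P.Point} (hx0 : ∀ i, x0 i ∈ P.X i) (hr : 0 ≤ r) (hHG : 0 ≤ H + G)
    (hyr : ∀ δ > 0, ∃ y, P.Feasible y ∧ P.objective y - v ≤ r + δ) {k : ℕ} (hk : 1 ≤ k) :
    (𝔼 ω, √(potential v (P.run2 O v x0 (fwStep N) k ω))) ≤
      r + 2 * N / k * √(potential v (P.run2 O v x0 (fwStep N) 0 Fin.elim0)) +
        4 * (H + G) / √k := by
  refine le_of_forall_pos_le_add fun δ hδ => ?_
  obtain ⟨y, hy, hyr⟩ := hyr δ hδ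
  have hk0 : (0 : ℝ) < k := by exact_mod_cast hk
  have hN1 : (1 : ℝ) ≤ N := by exact_mod_cast NeZero.one_le (n := N)
  have key := expect_potential_run2_le hO hH hG hx0 hy hyr k
  set F0 := potential v (P.run2 O v x0 (fwStep N) 0 Fin.elim0) with hF0
  have hF0' : 0 ≤ F0 := potential_nonneg _ _
  set a := 2 * N / k * √F0 with ha
  set c := 4 * (H + G) / √k with hc
  have ha0 : 0 ≤ a := by positivity
  have hc0 : 0 ≤ c := by positivity
  have ha2 : a ^ 2 = (2 * N) ^ 2 * F0 / k ^ 2 := by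
    rw [ha, mul_pow, Real.sq_sqrt hF0']; ring
  have hc2 : c ^ 2 = 16 * (H + G) ^ 2 * k / k ^ 2 := by
    rw [hc, div_pow, Real.sq_sqrt hk0.le]; field_simp; ring
  have h2 : (𝔼 ω, √(potential v (P.run2 O v x0 (fwStep N) k ω))) ≤ (r + δ) + a + c := by
    refine expect_le_of_expect_sq_le (by positivity) ?_
    simp only [Real.sq_sqrt (potential_nonneg _ _)]
    set e := 𝔼 ω, potential v (P.run2 O v x0 (fwStep N) k ω)
    have h3 : e - (r + δ) ^ 2 ≤ a ^ 2 + c ^ 2 := by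
      rw [ha2, hc2, ← add_div, le_div_iff₀ (by positivity)]
      rcases le_total (e - (r + δ) ^ 2) 0 with h | h
      · nlinarith [mul_nonneg (sq_nonneg (2 * (N : ℝ))) hF0',
          mul_nonneg (sq_nonneg (H + G)) hk0.le, sq_nonneg (k : ℝ)]
      · refine le_trans ?_ key
        gcongr
        linarith
    nlinarith [mul_nonneg ha0 hc0, mul_nonneg (add_nonneg hr hδ.le) ha0,
      mul_nonneg (add_nonneg hr hδ.le) hc0]
  linarith

/-! ### Stochastic dual subgradient iterations -/

variable (P) in
/-- The stochastic subgradient of the dual function at `μ` for the sampled block `i`. -/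
noncomputable def subgrad (O : P.Oracle) (μ : Vec m) (i : Fin N) : Vec m :=
  P.mulA i (O i 1 μ) - P.b

variable (P) in
/-- The state after `n` stochastic iterations of the first stage, from the zero multiplier and with
constant step size `a`. The first stage with parameter `T` makes `n = T - 1` such iterations. -/
noncomputable abbrev dualRun (O : P.Oracle) (a : ℝ) (n : ℕ) (ω : Fin n → Fin N) : P.State1 :=
  P.run1 O 0 (fun _ => a) n ω

variable (P) in
/-- The sum of `f s i` over the states `s` and sampled blocks `i` of the first `n` iterations. -/
noncomputable def pathSum {E : Type*} [AddCommMonoid E] (O : P.Oracle) (a : ℝ)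
    (f : P.State1 → Fin N → E) : (n : ℕ) → (Fin n → Fin N) → E
  | 0, _ => 0
  | n + 1, ω => pathSum O a f n (Fin.init ω) + f (P.dualRun O a n (Fin.init ω)) (ω (Fin.last n))

variable (P) in
/-- The sum of the dual values along the run. -/
noncomputable abbrev dualSum (O : P.Oracle) (a : ℝ) : (n : ℕ) → (Fin n → Fin N) → ℝ :=
  P.pathSum O a fun s _ => P.dual s.lam

variable (P) in
/-- The martingale of the deviations of the stochastic dual values from the dual values. -/
noncomputable abbrev dualDev (O : P.Oracle) (a : ℝ) : (n : ℕ) → (Fin n → Fin N) → ℝ :=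
  P.pathSum O a fun s i => P.blockDual O s.lam i - P.dual s.lam

theorem lam_nonneg (a : ℝ) (n : ℕ) (ω : Fin n → Fin N) (j : Fin m) :
    0 ≤ (P.dualRun O a n ω).lam j := by
  cases n with
  | zero => exact le_refl _
  | succ n => exact le_max_right _ _

theorem norm_subgrad_le {g : ℝ} (hO : P.IsArgminOracle O)
    (hg : ∀ i, ∀ x ∈ P.X i, ‖P.mulA i x - P.b‖ ≤ g) (μ : Vec m) (i : Fin N) :
    ‖P.subgrad O μ i‖ ≤ g := hg i _ (hO.mem i zero_le_one μ)

theorem norm_step1_sub_sq_le {a g : ℝ} (hO : P.IsArgminOracle O)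
    (hg : ∀ i, ∀ x ∈ P.X i, ‖P.mulA i x - P.b‖ ≤ g) (s : P.State1) (i : Fin N) {ν : Vec m}
    (hν : ∀ j, 0 ≤ ν j) :
    ‖(P.step1 O a s i).lam - ν‖ ^ 2 ≤
      ‖s.lam - ν‖ ^ 2 + 2 * a * inner ℝ (s.lam - ν) (P.subgrad O s.lam i) + a ^ 2 * g ^ 2 := by
  have h1 : ‖(P.step1 O a s i).lam - ν‖ ≤ ‖(s.lam - ν) + a • P.subgrad O s.lam i‖ := by
    refine (norm_projPos_sub_le _ ν hν).trans_eq ?_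
    congr 1
    unfold subgrad
    abel
  have h2 := pow_le_pow_left₀ (norm_nonneg _) h1 2
  rw [norm_add_sq_real, inner_smul_right, norm_smul, mul_pow, Real.norm_eq_abs, sq_abs] at h2
  have h3 := pow_le_pow_left₀ (norm_nonneg _) (norm_subgrad_le hO hg s.lam i) 2
  nlinarith [mul_le_mul_of_nonneg_left h3 (sq_nonneg a)]

/-- The convergence estimate of the stochastic subgradient method. -/
theorem expect_norm_lam_sub_sq_add_le [NeZero N] {a g : ℝ} (ha : 0 ≤ a) (hO : P.IsArgminOracle O)
    (hg : ∀ i, ∀ x ∈ P.X i, ‖P.mulA i x - P.b‖ ≤ g) {ν : Vec m} (hν : ∀ j, 0 ≤ ν j) (n : ℕ) :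
    (𝔼 ω, ‖(P.dualRun O a n ω).lam - ν‖ ^ 2) + 2 * a * (n * P.dual ν - 𝔼 ω, P.dualSum O a n ω) ≤
      ‖ν‖ ^ 2 + n * (a ^ 2 * g ^ 2) := by
  induction n with
  | zero => simp [dualRun, run1, pathSum]
  | succ n ih =>
    have h1 : (𝔼 ω, ‖(P.dualRun O a (n + 1) ω).lam - ν‖ ^ 2) ≤
        (𝔼 ω, ‖(P.dualRun O a n ω).lam - ν‖ ^ 2) +
          2 * a * ((𝔼 ω, P.dual (P.dualRun O a n ω).lam) - P.dual ν) + a ^ 2 * g ^ 2 := by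
      simp only [dualRun, run1]
      rw [expect_fin_succ
        (fun ω i => ‖(P.step1 O a (P.run1 O 0 (fun _ => a) n ω) i).lam - ν‖ ^ 2)]
      calc _ ≤ 𝔼 ω, (‖(P.dualRun O a n ω).lam - ν‖ ^ 2 +
            2 * a * (P.dual (P.dualRun O a n ω).lam - P.dual ν) + a ^ 2 * g ^ 2) := by
            refine Finset.expect_le_expect fun ω _ => ?_
            refine (Finset.expect_le_expect
              fun i _ => norm_step1_sub_sq_le (a := a) hO hg _ i hν).trans ?_
            rw [Finset.expect_add_distrib, Finset.expect_add_distrib, ← Finset.mul_expect,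
              Fintype.expect_const, Fintype.expect_const]
            have h2 := hO.dual_sub_le (P.dualRun O a n ω).lam ν
            have h3 : (𝔼 i, inner ℝ (ν - (P.dualRun O a n ω).lam)
                (P.mulA i (O i 1 (P.dualRun O a n ω).lam) - P.b)) =
                -𝔼 i, inner ℝ ((P.dualRun O a n ω).lam - ν)
                  (P.subgrad O (P.dualRun O a n ω).lam i) := by
              rw [← Finset.expect_neg_distrib]
              refine Finset.expect_congr rfl fun i _ => ?_
              rw [← inner_neg_left, neg_sub]
              rfl
            rw [h3] at h2
            have h4 : (𝔼 i, inner ℝ ((P.dualRun O a n ω).lam - ν)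
                (P.subgrad O (P.dualRun O a n ω).lam i)) ≤
                P.dual (P.dualRun O a n ω).lam - P.dual ν := by linarith
            gcongr
        _ = _ := by
            rw [Finset.expect_add_distrib, Finset.expect_add_distrib, ← Finset.mul_expect,
              Finset.expect_sub_distrib, Fintype.expect_const, Fintype.expect_const]
    have h2 : (𝔼 ω, P.dualSum O a (n + 1) ω) =
        (𝔼 ω, P.dualSum O a n ω) + 𝔼 ω, P.dual (P.dualRun O a n ω).lam := by
      simp only [dualSum, pathSum]
      rw [expect_fin_succ (fun ω _ => P.pathSum O a (fun s _ => P.dual s.lam) n ω +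
        P.dual (P.dualRun O a n ω).lam)]
      simp only [Fintype.expect_const, Finset.expect_add_distrib]
    rw [h2]
    push_cast
    linarith

theorem dualSum_le {ν : Vec m} (hν : P.IsDualMaximizer ν) (a : ℝ) (n : ℕ) (ω : Fin n → Fin N) :
    P.dualSum O a n ω ≤ n * P.dual ν := by
  induction n with
  | zero => simp [pathSum]
  | succ n ih =>
    have h1 := ih (Fin.init ω)
    have h2 := hν.2 _ (lam_nonneg (O := O) a n (Fin.init ω))
    simp only [dualSum, pathSum] at *
    push_cast
    linarith

theorem expect_norm_lam_sub_sq_le [NeZero N] {a g : ℝ} (ha : 0 ≤ a) (hO : P.IsArgminOracle O)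
    (hg : ∀ i, ∀ x ∈ P.X i, ‖P.mulA i x - P.b‖ ≤ g) {ν : Vec m} (hν : P.IsDualMaximizer ν)
    (n : ℕ) :
    (𝔼 ω, ‖(P.dualRun O a n ω).lam - ν‖ ^ 2) ≤ ‖ν‖ ^ 2 + n * (a ^ 2 * g ^ 2) := by
  have h1 := expect_norm_lam_sub_sq_add_le ha hO hg hν.1 n
  have h2 : (𝔼 ω, P.dualSum O a n ω) ≤ n * P.dual ν :=
    Finset.expect_le Finset.univ_nonempty fun ω _ => dualSum_le hν a n ω
  nlinarith

/-- The dual value at each multiplier is at most the Lagrangian value of any fixed `x`, which is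
affine in the multiplier. -/
theorem dualSum_le_lagrangian [NeZero N] (hO : P.IsArgminOracle O) (a : ℝ) {x : P.Point}
    (hx : ∀ i, x i ∈ P.X i) (n : ℕ) (ω : Fin n → Fin N) :
    P.dualSum O a n ω ≤
      n * P.objective x + inner ℝ (P.dualRun O a n ω).lamSum (P.residual x) := by
  induction n with
  | zero => simp [pathSum, dualRun, run1]
  | succ n ih =>
    have h1 := ih (Fin.init ω)
    have h2 := hO.dual_le (P.dualRun O a n (Fin.init ω)).lam hx
    simp only [dualSum, pathSum, dualRun, run1, step1, inner_add_left] at *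
    push_cast
    linarith

variable (P) in
/-- The average of the multipliers `λ_0, …, λ_n`. -/
noncomputable def lamBar (O : P.Oracle) (a : ℝ) (n : ℕ) (ω : Fin n → Fin N) : Vec m :=
  (1 / ((n : ℝ) + 1)) • ((P.dualRun O a n ω).lamSum + (P.dualRun O a n ω).lam)

/-- Jensen's inequality for the dual function, which is a minimum of affine functions. -/
theorem dualSum_add_le_dual_lamBar [NeZero N] (hO : P.IsArgminOracle O) (a : ℝ) (n : ℕ)
    (ω : Fin n → Fin N) :
    P.dualSum O a n ω + P.dual (P.dualRun O a n ω).lam ≤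
      ((n : ℝ) + 1) * P.dual (P.lamBar O a n ω) := by
  have hx : ∀ i, O i 1 (P.lamBar O a n ω) ∈ P.X i := fun i => hO.mem i zero_le_one _
  have h1 := dualSum_le_lagrangian hO a hx n ω
  have h2 := hO.dual_le (P.dualRun O a n ω).lam hx
  have h3 := hO.dual_eq (P.lamBar O a n ω)
  have h4 : ((n : ℝ) + 1) * inner ℝ (P.lamBar O a n ω)
      (P.residual fun i => O i 1 (P.lamBar O a n ω)) =
      inner ℝ (P.dualRun O a n ω).lamSum (P.residual fun i => O i 1 (P.lamBar O a n ω)) +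
      inner ℝ (P.dualRun O a n ω).lam (P.residual fun i => O i 1 (P.lamBar O a n ω)) := by
    generalize (P.residual fun i => O i 1 (P.lamBar O a n ω)) = R
    rw [lamBar, inner_smul_left, inner_add_left]
    simp only [conj_trivial]
    field_simp
  rw [h3, mul_add, h4]
  linarith

theorem dual_sub_le_norm [NeZero N] {g : ℝ} (hO : P.IsArgminOracle O)
    (hg : ∀ i, ∀ x ∈ P.X i, ‖P.mulA i x - P.b‖ ≤ g) (μ ν : Vec m) :
    P.dual ν - P.dual μ ≤ ‖μ - ν‖ * g := by
  refine (hO.dual_sub_le μ ν).trans (Finset.expect_le Finset.univ_nonempty fun i _ => ?_)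
  rw [norm_sub_rev]
  exact (real_inner_le_norm _ _).trans
    (mul_le_mul_of_nonneg_left (hg i _ (hO.mem i zero_le_one μ)) (norm_nonneg _))

theorem expect_dual_gap_le [NeZero N] {a g R : ℝ} (ha : 0 < a) (hg0 : 0 ≤ g) (hR : 0 ≤ R)
    (hO : P.IsArgminOracle O) (hg : ∀ i, ∀ x ∈ P.X i, ‖P.mulA i x - P.b‖ ≤ g) {ν : Vec m}
    (hν : P.IsDualMaximizer ν) (n : ℕ) (hRn : ‖ν‖ ^ 2 + n * (a ^ 2 * g ^ 2) ≤ R ^ 2) :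
    (𝔼 ω, (P.dual ν - P.dual (P.lamBar O a n ω))) ≤ (R ^ 2 / (2 * a) + R * g) / ((n : ℝ) + 1) := by
  have h1 := expect_norm_lam_sub_sq_add_le ha.le hO hg hν.1 n
  have h2 : (𝔼 ω, ‖(P.dualRun O a n ω).lam - ν‖) ≤ R :=
    expect_le_of_expect_sq_le hR ((expect_norm_lam_sub_sq_le ha.le hO hg hν n).trans hRn)
  have h3 : 0 ≤ 𝔼 ω, ‖(P.dualRun O a n ω).lam - ν‖ ^ 2 :=
    Finset.expect_nonneg fun ω _ => sq_nonneg _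
  rw [le_div_iff₀ (by positivity), mul_comm, Finset.mul_expect]
  calc _ ≤ 𝔼 ω, ((n * P.dual ν - P.dualSum O a n ω) +
        ‖(P.dualRun O a n ω).lam - ν‖ * g) := by
        refine Finset.expect_le_expect fun ω _ => ?_
        have h4 := dualSum_add_le_dual_lamBar hO a n ω
        have h5 := dual_sub_le_norm hO hg (P.dualRun O a n ω).lam ν
        linarith
    _ = (n * P.dual ν - 𝔼 ω, P.dualSum O a n ω) +
        (𝔼 ω, ‖(P.dualRun O a n ω).lam - ν‖) * g := by
        rw [Finset.expect_add_distrib, Finset.expect_sub_distrib, Fintype.expect_const,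
          Finset.expect_mul]
    _ ≤ _ := by
        gcongr
        rw [le_div_iff₀ (by positivity)]
        linarith

/-- The projection only increases coordinates, so that the multiplier dominates the accumulated
residuals of the sampled blocks. -/
theorem smul_pathSum_subgrad_le {a : ℝ} (n : ℕ) (ω : Fin n → Fin N) (j : Fin m) :
    (a • P.pathSum O a (fun s => P.subgrad O s.lam) n ω) j ≤ (P.dualRun O a n ω).lam j := by
  induction n with
  | zero => simp [pathSum, dualRun, run1]
  | succ n ih =>
    have h1 := ih (Fin.init ω)
    simp only [pathSum, dualRun, run1, step1, smul_add, PiLp.add_apply, projPos_apply] at *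
    refine le_trans ?_ (le_max_left _ _)
    gcongr
    exact le_refl _

/-- The complementary slackness terms `⟨λ_t, A x - b⟩` of the sampled blocks cannot be very
negative in total, since each of them decreases `‖λ_t‖²`. -/
theorem pathSum_hval_le {a g : ℝ} (hO : P.IsArgminOracle O)
    (hg : ∀ i, ∀ x ∈ P.X i, ‖P.mulA i x - P.b‖ ≤ g) (n : ℕ) (ω : Fin n → Fin N) :
    2 * a * P.pathSum O a (fun s i => P.hval i (O i 1 s.lam)) n ω +
        ‖(P.dualRun O a n ω).lam‖ ^ 2 ≤
      2 * a * (P.dualDev O a n ω + P.dualSum O a n ω) + n * (a ^ 2 * g ^ 2) := by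
  induction n with
  | zero => simp [pathSum, dualRun, run1]
  | succ n ih =>
    have h1 := ih (Fin.init ω)
    have h2 := norm_step1_sub_sq_le (a := a) hO hg (P.dualRun O a n (Fin.init ω))
      (ω (Fin.last n)) (ν := 0) fun j => le_refl _
    simp only [sub_zero] at h2
    simp only [dualDev, dualSum, pathSum, dualRun, run1, blockDual, subgrad] at *
    push_cast
    linarith

theorem expect_dualDev_sq_le [NeZero N] {a g H : ℝ} (ha : 0 ≤ a) (hO : P.IsArgminOracle O)
    (hg : ∀ i, ∀ x ∈ P.X i, ‖P.mulA i x - P.b‖ ≤ g)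
    (hH : ∀ i, ∀ x ∈ P.X i, |P.hval i x| ≤ H) {ν : Vec m} (hν : P.IsDualMaximizer ν) (n : ℕ) :
    (𝔼 ω, P.dualDev O a n ω ^ 2) ≤
      n * (2 * H ^ 2 + 2 * g ^ 2 * (4 * ‖ν‖ ^ 2 + 2 * n * (a ^ 2 * g ^ 2))) := by
  induction n with
  | zero => simp [pathSum]
  | succ n ih =>
    have h1 : (𝔼 ω, P.dualDev O a (n + 1) ω ^ 2) ≤ (𝔼 ω, P.dualDev O a n ω ^ 2) +
        (2 * H ^ 2 + 2 * g ^ 2 * 𝔼 ω, ‖(P.dualRun O a n ω).lam‖ ^ 2) := by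
      simp only [dualDev, pathSum]
      rw [expect_fin_succ (fun ω i => (P.pathSum O a (fun s i => P.blockDual O s.lam i -
        P.dual s.lam) n ω + (P.blockDual O (P.dualRun O a n ω).lam i -
        P.dual (P.dualRun O a n ω).lam)) ^ 2)]
      rw [Finset.mul_expect, ← Fintype.expect_const (ι := Fin n → Fin N) (2 * H ^ 2),
        ← Finset.expect_add_distrib, ← Finset.expect_add_distrib]
      refine Finset.expect_le_expect fun ω _ => ?_
      set D := P.pathSum O a (fun s i => P.blockDual O s.lam i - P.dual s.lam) n ω
      set μ := (P.dualRun O a n ω).lam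
      simp only [add_sq, Finset.expect_add_distrib, Fintype.expect_const, ← Finset.mul_expect,
        Finset.expect_sub_distrib, hO.expect_blockDual, sub_self, mul_zero, add_zero]
      have h2 := expect_sub_sq (P.blockDual O μ)
      rw [hO.expect_blockDual] at h2
      have h3 : (𝔼 i, P.blockDual O μ i ^ 2) ≤ 2 * H ^ 2 + 2 * g ^ 2 * ‖μ‖ ^ 2 := by
        refine Finset.expect_le Finset.univ_nonempty fun i _ => ?_
        have h4 : |P.blockDual O μ i| ≤ H + ‖μ‖ * g := by
          refine (abs_add_le _ _).trans (add_le_add (hH i _ (hO.mem i zero_le_one μ)) ?_)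
          exact (abs_real_inner_le_norm _ _).trans
            (mul_le_mul_of_nonneg_left (norm_subgrad_le hO hg μ i) (norm_nonneg _))
        have h5 := pow_le_pow_left₀ (abs_nonneg _) h4 2
        rw [sq_abs] at h5
        nlinarith [sq_nonneg (H - ‖μ‖ * g)]
      rw [h2]
      linarith [sq_nonneg (P.dual μ)]
    have h2 : (𝔼 ω, ‖(P.dualRun O a n ω).lam‖ ^ 2) ≤
        4 * ‖ν‖ ^ 2 + 2 * n * (a ^ 2 * g ^ 2) := by
      calc _ ≤ 𝔼 ω, (2 * ‖(P.dualRun O a n ω).lam - ν‖ ^ 2 + 2 * ‖ν‖ ^ 2) := by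
            refine Finset.expect_le_expect fun ω _ => ?_
            have h3 : ‖(P.dualRun O a n ω).lam‖ ≤ ‖(P.dualRun O a n ω).lam - ν‖ + ‖ν‖ := by
              simpa using norm_add_le ((P.dualRun O a n ω).lam - ν) ν
            have h4 := pow_le_pow_left₀ (norm_nonneg _) h3 2
            nlinarith [sq_nonneg (‖(P.dualRun O a n ω).lam - ν‖ - ‖ν‖)]
        _ = 2 * (𝔼 ω, ‖(P.dualRun O a n ω).lam - ν‖ ^ 2) + 2 * ‖ν‖ ^ 2 := by
            rw [Finset.expect_add_distrib, ← Finset.mul_expect, Fintype.expect_const]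
        _ ≤ _ := by
            have := expect_norm_lam_sub_sq_le ha hO hg hν n
            linarith
    have h3 := mul_le_mul_of_nonneg_left h2 (by positivity : 0 ≤ 2 * g ^ 2)
    have h4 : 0 ≤ ((n : ℝ) + 1) * (2 * g ^ 2 * (2 * (a ^ 2 * g ^ 2))) := by positivity
    push_cast
    linarith

/-! ### Sampling frequencies -/

/-- The variance of the numbers of samples of all blocks. -/
theorem expect_count_sq_le [NeZero N] (a : ℝ) (n : ℕ) :
    (𝔼 ω, ∑ i, (((P.dualRun O a n ω).count i : ℝ) - n / N) ^ 2) ≤ n := by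
  have hN : (N : ℝ) ≠ 0 := by exact_mod_cast NeZero.ne N
  induction n with
  | zero => simp [dualRun, run1]
  | succ n ih =>
    have h1 : (𝔼 ω, ∑ i, (((P.dualRun O a (n + 1) ω).count i : ℝ) - (n + 1 : ℕ) / N) ^ 2) ≤
        (𝔼 ω, ∑ i, (((P.dualRun O a n ω).count i : ℝ) - n / N) ^ 2) + 1 := by
      simp only [dualRun, run1]
      rw [expect_fin_succ (fun ω k => ∑ i,
        (((P.step1 O a (P.run1 O 0 (fun _ => a) n ω) k).count i : ℝ) - (n + 1 : ℕ) / N) ^ 2)]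
      conv_rhs => rw [← Fintype.expect_const (ι := Fin n → Fin N) (1 : ℝ)]
      rw [← Finset.expect_add_distrib]
      refine Finset.expect_le_expect fun ω _ => ?_
      set c := (P.run1 O 0 (fun _ => a) n ω).count with hc
      have h2 : ∀ k i, (((P.step1 O a (P.run1 O 0 (fun _ => a) n ω) k).count i : ℝ) -
          (n + 1 : ℕ) / N) = ((c i : ℝ) - n / N) + ((if i = k then 1 else 0) - 1 / (N : ℝ)) := by
        intro k i
        by_cases hik : i = k
        · subst hik
          simp only [step1, Function.update_self, if_true]
          push_cast
          ring
        · simp only [step1, Function.update_of_ne hik, if_neg hik]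
          push_cast
          ring
      simp only [h2]
      rw [Finset.expect_sum_comm]
      have h3 : ∀ i : Fin N, (𝔼 k, (((c i : ℝ) - n / N) +
          ((if i = k then 1 else 0) - 1 / (N : ℝ))) ^ 2) =
          ((c i : ℝ) - n / N) ^ 2 + (1 / (N : ℝ) - (1 / (N : ℝ)) ^ 2) := by
        intro i
        have h4 : (𝔼 k : Fin N, (if i = k then (1 : ℝ) else 0)) = 1 / N := by
          rw [expect_fin_eq]; simp
        have h5 := expect_sub_sq (fun k : Fin N => (if i = k then (1 : ℝ) else 0))
        have h6 : ∀ k : Fin N, (if i = k then (1 : ℝ) else 0) ^ 2 = if i = k then 1 else 0 := by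
          intro k; split_ifs <;> norm_num
        simp only [h4, h6] at h5
        simp only [add_sq ((c i : ℝ) - n / N), Finset.expect_add_distrib, Fintype.expect_const,
          ← Finset.mul_expect, Finset.expect_sub_distrib, h4, sub_self, mul_zero, add_zero, h5]
      simp only [h3, Finset.sum_add_distrib, Finset.sum_const, Finset.card_univ,
        Fintype.card_fin, nsmul_eq_mul]
      have h7 : (N : ℝ) * (1 / (N : ℝ) - (1 / (N : ℝ)) ^ 2) = 1 - 1 / N := by
        field_simp
      have h8 : (0 : ℝ) ≤ 1 / N := by positivity
      rw [h7]
      linarith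
    push_cast at h1 ⊢
    linarith

variable (P) in
/-- The deviation of the relative sampling frequencies from `1/N`, where the last call of the
oracle for each block is counted as a sample. -/
noncomputable def freqDev (O : P.Oracle) (a : ℝ) (n : ℕ) (ω : Fin n → Fin N) : ℝ :=
  ∑ i, |1 / (N : ℝ) - (((P.dualRun O a n ω).count i : ℝ) + 1) / ((n : ℝ) + 1)|

theorem expect_freqDev_le [NeZero N] (a : ℝ) (n : ℕ) :
    (𝔼 ω, P.freqDev O a n ω) ≤ (√(N * n) + N) / ((n : ℝ) + 1) := by
  have hN1 : (1 : ℝ) ≤ N := by exact_mod_cast NeZero.one_le (n := N)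
  have h1 : (𝔼 ω, ∑ i, |((P.dualRun O a n ω).count i : ℝ) - n / N|) ≤ √(N * n) := by
    refine expect_le_of_expect_sq_le (Real.sqrt_nonneg _) ?_
    rw [Real.sq_sqrt (by positivity)]
    calc _ ≤ 𝔼 ω, N * ∑ i, (((P.dualRun O a n ω).count i : ℝ) - n / N) ^ 2 := by
          refine Finset.expect_le_expect fun ω _ => ?_
          have := sq_sum_le_card_mul_sum_sq (s := Finset.univ)
            (f := fun i => |((P.dualRun O a n ω).count i : ℝ) - n / N|)
          simpa using this
      _ ≤ _ := by
          rw [← Finset.mul_expect]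
          gcongr
          exact expect_count_sq_le a n
  rw [le_div_iff₀ (by positivity), Finset.expect_mul]
  calc _ ≤ 𝔼 ω, ((∑ i, |((P.dualRun O a n ω).count i : ℝ) - n / N|) + N) := by
        refine Finset.expect_le_expect fun ω _ => ?_
        rw [freqDev, Finset.sum_mul]
        have h2 : (∑ i, |((P.dualRun O a n ω).count i : ℝ) - n / N|) + N =
            ∑ i : Fin N, (|((P.dualRun O a n ω).count i : ℝ) - n / N| + 1) := by
          simp [Finset.sum_add_distrib]
        rw [h2]
        refine Finset.sum_le_sum fun i _ => ?_
        rw [← abs_of_pos (by positivity : (0 : ℝ) < (n : ℝ) + 1), ← abs_mul,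
          abs_of_pos (by positivity : (0 : ℝ) < (n : ℝ) + 1)]
        have h3 : (1 / (N : ℝ) - (((P.dualRun O a n ω).count i : ℝ) + 1) / ((n : ℝ) + 1)) *
            ((n : ℝ) + 1) = -(((P.dualRun O a n ω).count i : ℝ) - n / N) + (1 / N - 1) := by
          field_simp
          ring
        rw [h3]
        refine (abs_add_le _ _).trans ?_
        rw [abs_neg]
        gcongr
        have h4 : 1 / (N : ℝ) ≤ 1 := div_le_one_of_le₀ hN1 (by positivity)
        have h5 : (0 : ℝ) ≤ 1 / N := by positivity
        rw [abs_le]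
        constructor <;> linarith
    _ ≤ _ := by
        rw [Finset.expect_add_distrib, Fintype.expect_const]
        linarith

/-- Averaging within each block differs from averaging over all samples only as far as the
sampling frequencies differ from `1/N`. -/
theorem norm_blockAverage_sub_le {E : Type*} [NormedAddCommGroup E] [NormedSpace ℝ E]
    (U : Fin N → E) (c : Fin N → ℝ) (hc : ∀ i, 0 < c i) {g T : ℝ} (hU : ∀ i, ‖U i‖ ≤ c i * g) :
    ‖(1 / (N : ℝ)) • ∑ i, (1 / c i) • U i - (1 / T) • ∑ i, U i‖ ≤
      g * ∑ i, |1 / (N : ℝ) - c i / T| := by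
  rw [Finset.smul_sum, Finset.smul_sum, ← Finset.sum_sub_distrib, Finset.mul_sum]
  refine (norm_sum_le _ _).trans (Finset.sum_le_sum fun i _ => ?_)
  have h1 : (1 / (N : ℝ)) • (1 / c i) • U i - (1 / T) • U i =
      ((1 / (N : ℝ) - c i / T) * (1 / c i)) • U i := by
    have h2 : (1 / (N : ℝ) - c i / T) * (1 / c i) = 1 / (N : ℝ) * (1 / c i) - 1 / T := by
      have := (hc i).ne'
      rw [sub_mul]
      congr 1
      rw [div_mul_div_comm, mul_one, mul_comm T, div_mul_eq_div_div, div_self this]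
    rw [h2]
    module
  rw [h1, norm_smul, norm_mul, Real.norm_eq_abs, Real.norm_eq_abs,
    abs_of_pos (one_div_pos.2 (hc i))]
  calc _ ≤ |1 / (N : ℝ) - c i / T| * (1 / c i) * (c i * g) := by
        have := hc i
        gcongr
        exact hU i
    _ = _ := by
        have := (hc i).ne'
        field_simp

/-! ### The output of the first stage -/

variable (P) in
/-- The primal candidate of the first stage, averaged block by block. -/
noncomputable def xBar (O : P.Oracle) (a : ℝ) (n : ℕ) (ω : Fin n → Fin N) : P.Point := fun i =>
  (1 / (((P.dualRun O a n ω).count i : ℝ) + 1)) •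
    ((P.dualRun O a n ω).xSum i + O i 1 (P.dualRun O a n ω).lam)

variable (P) in
/-- For each block, the sum of the values of `hᵢ` at the oracle outputs of that block. -/
noncomputable abbrev hvalSums (O : P.Oracle) (a : ℝ) : (n : ℕ) → (Fin n → Fin N) → Fin N → ℝ :=
  P.pathSum O a fun s i => Pi.single i (P.hval i (O i 1 s.lam))

/-- Jensen's inequality for a block average of oracle outputs and one further point `y`. -/
theorem hval_blockAverage_le (hO : P.IsArgminOracle O) (a : ℝ) (n : ℕ) (ω : Fin n → Fin N)
    (i : Fin N) {y : Vec (P.dim i)} (hy : y ∈ P.X i) :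
    (1 / (((P.dualRun O a n ω).count i : ℝ) + 1)) • ((P.dualRun O a n ω).xSum i + y) ∈ P.X i ∧
    P.hval i ((1 / (((P.dualRun O a n ω).count i : ℝ) + 1)) •
      ((P.dualRun O a n ω).xSum i + y)) ≤
      (1 / (((P.dualRun O a n ω).count i : ℝ) + 1)) *
        (P.hvalSums O a n ω i + P.hval i y) := by
  induction n generalizing y with
  | zero => simpa [dualRun, run1, pathSum] using hy
  | succ n ih =>
    set s := P.dualRun O a n (Fin.init ω) with hs
    set η := P.hvalSums O a n (Fin.init ω) with hη
    have hs' : P.dualRun O a (n + 1) ω = P.step1 O a s (ω (Fin.last n)) := rfl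
    have hη' : P.hvalSums O a (n + 1) ω =
        η + Pi.single (ω (Fin.last n)) (P.hval _ (O (ω (Fin.last n)) 1 s.lam)) := rfl
    rw [hs', hη']
    generalize ω (Fin.last n) = k
    by_cases hi : i = k
    · subst hi
      obtain ⟨h1, h2⟩ := ih (Fin.init ω) (hO.mem i zero_le_one s.lam)
      simp only [← hs, ← hη] at h1 h2
      set x := O i 1 s.lam with hx
      have hc : (0 : ℝ) < (s.count i : ℝ) + 1 := by positivity
      have hc2 : (0 : ℝ) < (s.count i : ℝ) + 1 + 1 := by positivity
      have h3 := P.hval_convex h1 hy (a := ((s.count i : ℝ) + 1) / ((s.count i : ℝ) + 1 + 1))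
        (c := 1 / ((s.count i : ℝ) + 1 + 1)) (by positivity) (by positivity) (by field_simp)
      have h4 : (((s.count i : ℝ) + 1) / ((s.count i : ℝ) + 1 + 1)) •
          (1 / ((s.count i : ℝ) + 1)) • (s.xSum i + x) + (1 / ((s.count i : ℝ) + 1 + 1)) • y =
          (1 / ((s.count i : ℝ) + 1 + 1)) • (s.xSum i + x + y) := by
        rw [smul_smul, smul_add _ _ y]
        congr 2
        field_simp
      rw [h4] at h3
      simp only [step1, Function.update_self, Pi.add_apply, Pi.single_eq_same]
      rw [← hx]
      push_cast
      refine ⟨h3.1, h3.2.trans ?_⟩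
      have h5 := mul_le_mul_of_nonneg_left h2
        (by positivity : 0 ≤ ((s.count i : ℝ) + 1) / ((s.count i : ℝ) + 1 + 1))
      have h6 : ((s.count i : ℝ) + 1) / ((s.count i : ℝ) + 1 + 1) *
          (1 / ((s.count i : ℝ) + 1) * (η i + P.hval i x)) =
          1 / ((s.count i : ℝ) + 1 + 1) * (η i + P.hval i x) := by
        field_simp
      rw [h6] at h5
      linarith
    · simpa [step1, Function.update_of_ne hi, Pi.single_eq_of_ne hi] using ih (Fin.init ω) hy

theorem abs_hvalSums_le {H : ℝ} (hO : P.IsArgminOracle O)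
    (hH : ∀ i, ∀ x ∈ P.X i, |P.hval i x| ≤ H) (a : ℝ) (n : ℕ) (ω : Fin n → Fin N) (i : Fin N) :
    |P.hvalSums O a n ω i| ≤ (P.dualRun O a n ω).count i * H := by
  induction n with
  | zero => simp [pathSum, dualRun, run1]
  | succ n ih =>
    have h1 := ih (Fin.init ω)
    by_cases hi : i = ω (Fin.last n)
    · subst hi
      simp only [hvalSums, pathSum, dualRun, run1, step1, Function.update_self, Pi.add_apply,
        Pi.single_eq_same] at *
      push_cast
      refine (abs_add_le _ _).trans ?_
      have h2 := hH _ _ (hO.mem (ω (Fin.last n)) zero_le_one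
        (P.run1 O 0 (fun _ => a) n (Fin.init ω)).lam)
      linarith
    · simpa [hvalSums, pathSum, dualRun, run1, step1, Function.update_of_ne hi,
        Pi.single_eq_of_ne hi] using h1

theorem sum_hvalSums (a : ℝ) (n : ℕ) (ω : Fin n → Fin N) :
    ∑ i, P.hvalSums O a n ω i = P.pathSum O a (fun s i => P.hval i (O i 1 s.lam)) n ω := by
  induction n with
  | zero => simp [pathSum]
  | succ n ih => simp [hvalSums, pathSum, Finset.sum_add_distrib, ← ih]

theorem norm_mulA_xSum_le {g : ℝ} (hO : P.IsArgminOracle O)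
    (hg : ∀ i, ∀ x ∈ P.X i, ‖P.mulA i x - P.b‖ ≤ g) (a : ℝ) (n : ℕ) (ω : Fin n → Fin N)
    (i : Fin N) :
    ‖P.mulA i ((P.dualRun O a n ω).xSum i) - ((P.dualRun O a n ω).count i : ℝ) • P.b‖ ≤
      (P.dualRun O a n ω).count i * g := by
  induction n with
  | zero => simp [dualRun, run1]
  | succ n ih =>
    have h1 := ih (Fin.init ω)
    by_cases hi : i = ω (Fin.last n)
    · subst hi
      simp only [dualRun, run1, step1, Function.update_self, mulA_add] at *
      push_cast
      have h2 := norm_subgrad_le hO hg (P.run1 O 0 (fun _ => a) n (Fin.init ω)).lam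
        (ω (Fin.last n))
      rw [add_smul, one_smul, add_sub_add_comm]
      refine (norm_add_le _ _).trans ?_
      unfold subgrad at h2
      linarith
    · simpa [dualRun, run1, step1, Function.update_of_ne hi] using h1

theorem sum_mulA_xSum (a : ℝ) (n : ℕ) (ω : Fin n → Fin N) :
    ∑ i, (P.mulA i ((P.dualRun O a n ω).xSum i) - ((P.dualRun O a n ω).count i : ℝ) • P.b) =
      P.pathSum O a (fun s => P.subgrad O s.lam) n ω := by
  induction n with
  | zero => simp [dualRun, run1, pathSum]
  | succ n ih =>
    rw [pathSum, ← ih]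
    set s := P.dualRun O a n (Fin.init ω)
    have h1 : (fun i => P.mulA i ((P.dualRun O a (n + 1) ω).xSum i) -
        ((P.dualRun O a (n + 1) ω).count i : ℝ) • P.b) =
        Function.update (fun i => P.mulA i (s.xSum i) - (s.count i : ℝ) • P.b) (ω (Fin.last n))
          (P.mulA _ (s.xSum (ω (Fin.last n))) - (s.count (ω (Fin.last n)) : ℝ) • P.b +
            P.subgrad O s.lam (ω (Fin.last n))) := by
      funext i
      have hs' : P.dualRun O a (n + 1) ω = P.step1 O a s (ω (Fin.last n)) := rfl
      rw [hs']
      by_cases hi : i = ω (Fin.last n)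
      · subst hi
        simp only [step1, Function.update_self, mulA_add, subgrad]
        push_cast
        module
      · simp [step1, Function.update_of_ne hi]
    rw [h1, sum_update_eq]
    abel

theorem normPos_residual_xBar_le {a g : ℝ} (ha : 0 < a) (hO : P.IsArgminOracle O)
    (hg : ∀ i, ∀ x ∈ P.X i, ‖P.mulA i x - P.b‖ ≤ g) (hN : 0 < N) (n : ℕ) (ω : Fin n → Fin N) :
    normPos (P.residual (P.xBar O a n ω)) ≤
      ‖(P.dualRun O a n ω).lam‖ / (a * ((n : ℝ) + 1)) + N * g / ((n : ℝ) + 1) +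
        g * P.freqDev O a n ω := by
  set s := P.dualRun O a n ω with hs
  set S := P.pathSum O a (fun s => P.subgrad O s.lam) n ω with hS
  set U : Fin N → Vec m := fun i =>
    (P.mulA i (s.xSum i) - (s.count i : ℝ) • P.b) + P.subgrad O s.lam i with hU
  have hNr : (N : ℝ) ≠ 0 := by exact_mod_cast hN.ne'
  have hT : (0 : ℝ) < (n : ℝ) + 1 := by positivity
  have hres : P.residual (P.xBar O a n ω) =
      (1 / (N : ℝ)) • ∑ i, (1 / ((s.count i : ℝ) + 1)) • U i := by
    have h1 : ∀ i, (1 / ((s.count i : ℝ) + 1)) • U i = P.mulA i (P.xBar O a n ω i) - P.b := by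
      intro i
      have hc : (s.count i : ℝ) + 1 ≠ 0 := by positivity
      have h2 : U i = P.mulA i (s.xSum i + O i 1 s.lam) - ((s.count i : ℝ) + 1) • P.b := by
        simp only [hU, subgrad, mulA_add]
        module
      rw [h2, smul_sub, smul_smul, one_div_mul_cancel hc, one_smul, xBar, mulA_smul]
    simp only [h1, Finset.sum_sub_distrib, residual, smul_sub]
    congr 1
    rw [Finset.sum_const, Finset.card_univ, Fintype.card_fin, ← Nat.cast_smul_eq_nsmul ℝ,
      smul_smul, one_div_mul_cancel hNr, one_smul]
  have h1 := norm_blockAverage_sub_le U (fun i => (s.count i : ℝ) + 1) (fun i => by positivity)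
    (g := g) (T := (n : ℝ) + 1) (fun i => by
      have h2 := norm_mulA_xSum_le hO hg a n ω i
      have h3 := norm_subgrad_le hO hg s.lam i
      exact (norm_add_le _ _).trans (by linarith))
  have hsum : ∑ i, U i = S + ∑ i, P.subgrad O s.lam i := by
    simp only [hU]
    rw [Finset.sum_add_distrib, hS, ← sum_mulA_xSum]
  have h2 : normPos ((1 / ((n : ℝ) + 1)) • S) ≤ ‖s.lam‖ / (a * ((n : ℝ) + 1)) := by
    rw [normPos_smul (by positivity)]
    have h3 := normPos_le_norm_of_le (smul_pathSum_subgrad_le (P := P) (O := O) (a := a) n ω)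
    rw [normPos_smul ha.le] at h3
    rw [le_div_iff₀ (by positivity)]
    calc _ = a * normPos S := by field_simp
      _ ≤ _ := h3
  have h3 : ‖(1 / ((n : ℝ) + 1)) • ∑ i, P.subgrad O s.lam i‖ ≤ N * g / ((n : ℝ) + 1) := by
    rw [norm_smul, Real.norm_of_nonneg (by positivity)]
    have h4 : ‖∑ i, P.subgrad O s.lam i‖ ≤ N * g := by
      refine (norm_sum_le_of_le _ fun i _ => norm_subgrad_le hO hg s.lam i).trans_eq ?_
      simp
    calc _ ≤ 1 / ((n : ℝ) + 1) * (N * g) := by gcongr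
      _ = _ := by ring
  have h4 : P.residual (P.xBar O a n ω) = (1 / ((n : ℝ) + 1)) • S +
      ((1 / ((n : ℝ) + 1)) • ∑ i, P.subgrad O s.lam i +
        (P.residual (P.xBar O a n ω) - (1 / ((n : ℝ) + 1)) • ∑ i, U i)) := by
    rw [hsum, smul_add]
    abel
  rw [h4]
  refine (normPos_add_le _ _).trans ?_
  rw [hres]
  have h5 := norm_add_le ((1 / ((n : ℝ) + 1)) • ∑ i, P.subgrad O s.lam i)
    ((1 / (N : ℝ)) • ∑ i, (1 / ((s.count i : ℝ) + 1)) • U i - (1 / ((n : ℝ) + 1)) • ∑ i, U i)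
  have h6 : P.freqDev O a n ω = ∑ i, |1 / (N : ℝ) - ((s.count i : ℝ) + 1) / ((n : ℝ) + 1)| := rfl
  rw [h6]
  linarith

theorem objective_xBar_le {H : ℝ} (hO : P.IsArgminOracle O)
    (hH : ∀ i, ∀ x ∈ P.X i, |P.hval i x| ≤ H) (a : ℝ) (n : ℕ) (ω : Fin n → Fin N) :
    P.objective (P.xBar O a n ω) ≤
      P.pathSum O a (fun s i => P.hval i (O i 1 s.lam)) n ω / ((n : ℝ) + 1) +
        N * H / ((n : ℝ) + 1) + H * P.freqDev O a n ω := by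
  set s := P.dualRun O a n ω with hs
  set U : Fin N → ℝ := fun i => P.hvalSums O a n ω i + P.hval i (O i 1 s.lam) with hU
  have hlast : ∀ i, |P.hval i (O i 1 s.lam)| ≤ H := fun i => hH i _ (hO.mem i zero_le_one _)
  have h1 := norm_blockAverage_sub_le U (fun i => (s.count i : ℝ) + 1) (fun i => by positivity)
    (g := H) (T := (n : ℝ) + 1) (fun i => by
      have h2 := abs_hvalSums_le hO hH a n ω i
      have h3 := hlast i
      exact (norm_add_le _ _).trans (by simp only [Real.norm_eq_abs]; linarith))
  simp only [smul_eq_mul] at h1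
  have h2 : P.objective (P.xBar O a n ω) ≤
      (1 / (N : ℝ)) * ∑ i, (1 / ((s.count i : ℝ) + 1)) * U i := by
    unfold objective
    gcongr with i
    exact (hval_blockAverage_le hO a n ω i (hO.mem i zero_le_one s.lam)).2
  have h3 : ∑ i, U i ≤ P.pathSum O a (fun s i => P.hval i (O i 1 s.lam)) n ω + N * H := by
    simp only [hU]
    rw [Finset.sum_add_distrib, sum_hvalSums]
    gcongr
    calc _ ≤ ∑ i : Fin N, H := Finset.sum_le_sum fun i _ => (le_abs_self _).trans (hlast i)
      _ = _ := by simp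
  have h4 := (le_abs_self _).trans h1
  have h5 : 1 / ((n : ℝ) + 1) * ∑ i, U i ≤
      P.pathSum O a (fun s i => P.hval i (O i 1 s.lam)) n ω / ((n : ℝ) + 1) +
        N * H / ((n : ℝ) + 1) := by
    rw [← add_div, one_div_mul_eq_div]
    gcongr
  have h6 : P.freqDev O a n ω = ∑ i, |1 / (N : ℝ) - ((s.count i : ℝ) + 1) / ((n : ℝ) + 1)| := rfl
  rw [h6]
  linarith

theorem xBar_mem (hO : P.IsArgminOracle O) (a : ℝ) (n : ℕ) (ω : Fin n → Fin N) (i : Fin N) :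
    P.xBar O a n ω i ∈ P.X i :=
  (hval_blockAverage_le hO a n ω i (hO.mem i zero_le_one _)).1

theorem lamBar_nonneg (a : ℝ) (n : ℕ) (ω : Fin n → Fin N) (j : Fin m) :
    0 ≤ P.lamBar O a n ω j := by
  have h1 : 0 ≤ (P.dualRun O a n ω).lamSum j := by
    induction n with
    | zero => simp [dualRun, run1]
    | succ n ih =>
      have h2 := lam_nonneg (O := O) a n (Fin.init ω) j
      have h3 := ih (Fin.init ω)
      simp only [dualRun, run1, step1, PiLp.add_apply] at *
      linarith
  have h2 := lam_nonneg (O := O) a n ω j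
  rw [lamBar, PiLp.smul_apply, PiLp.add_apply, smul_eq_mul]
  positivity

theorem calls_run1 {lam0 : Vec m} {α : ℕ → ℝ} (n : ℕ) (ω : Fin n → Fin N) :
    (P.run1 O lam0 α n ω).calls = n := by
  induction n with
  | zero => rfl
  | succ n ih => simp [run1, step1, ih]

theorem stage1_eq (a : ℝ) (n : ℕ) (ω : Fin n → Fin N) :
    P.stage1 O 0 (fun _ => a) (n + 1) ω =
      { lamBar := P.lamBar O a n ω, xBar := P.xBar O a n ω, calls := n + N } := by
  simp only [stage1, lamBar, Nat.add_sub_cancel, calls_run1, Nat.cast_add, Nat.cast_one]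
  rfl

/-- If all stochastic subgradients vanish, the step size is irrelevant. -/
theorem run1_eq_of_subgrad_eq_zero (hO : P.IsArgminOracle O)
    (h0 : ∀ i, ∀ x ∈ P.X i, P.mulA i x - P.b = 0) (a a' : ℝ) (n : ℕ) (ω : Fin n → Fin N) :
    P.dualRun O a n ω = P.dualRun O a' n ω := by
  induction n with
  | zero => rfl
  | succ n ih =>
    simp only [dualRun, run1] at *
    rw [ih]
    simp [step1, h0 _ _ (hO.mem (ω (Fin.last n)) zero_le_one _)]

/-! ### Rates of the first stage -/

/-- The constant in the rate of the dual suboptimality. -/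
noncomputable def gapConst (G L Λ : ℝ) : ℝ := G * ((L + Λ) ^ 2 / (2 * Λ) + (L + Λ))

/-- The constant in the rate of the primal candidate of the first stage. -/
noncomputable def startConst (G H L Λ : ℝ) : ℝ :=
  gapConst G L Λ + (2 * H + 4 * G * L + 2 * G * Λ) + G * Λ / 2 + 4 * H +
    G * ((2 * L + Λ) / Λ + 3)

/-- The hypotheses on the first stage: the step size is `Λ / (g√T)` for a positive bound `g` of the
stochastic subgradients, which exists even if `G̃ = 0`. -/
structure Stage1Data (P : SeparableProblem N m) (O : P.Oracle) (ν : Vec m)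
    (G H L Λ g a : ℝ) (n : ℕ) : Prop where
  oracle : P.IsArgminOracle O
  maximizer : P.IsDualMaximizer ν
  norm_le : ‖ν‖ ≤ L
  subgrad_le : ∀ i, ∀ x ∈ P.X i, ‖P.mulA i x - P.b‖ ≤ g
  hval_le : ∀ i, ∀ x ∈ P.X i, |P.hval i x| ≤ H
  pos_Λ : 0 < Λ
  pos_g : 0 < g
  g_le : g ≤ G
  H_nonneg : 0 ≤ H
  step : a = Λ / (g * √((n : ℝ) + 1))

namespace Stage1Data

variable {ν : Vec m} {G H L Λ g a : ℝ} {n : ℕ}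

theorem pos_a (h : Stage1Data P O ν G H L Λ g a n) : 0 < a := by
  rw [h.step]
  have := h.pos_Λ
  have := h.pos_g
  positivity

theorem L_nonneg (h : Stage1Data P O ν G H L Λ g a n) : 0 ≤ L := (norm_nonneg _).trans h.norm_le

theorem G_pos (h : Stage1Data P O ν G H L Λ g a n) : 0 < G := h.pos_g.trans_le h.g_le

theorem step_sq (h : Stage1Data P O ν G H L Λ g a n) :
    ((n : ℝ) + 1) * (a ^ 2 * g ^ 2) = Λ ^ 2 := by
  have hg := h.pos_g.ne'
  have hT : (0 : ℝ) < (n : ℝ) + 1 := by positivity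
  rw [h.step, div_pow, mul_pow, Real.sq_sqrt hT.le]
  field_simp

theorem radius_le (h : Stage1Data P O ν G H L Λ g a n) :
    ‖ν‖ ^ 2 + n * (a ^ 2 * g ^ 2) ≤ (L + Λ) ^ 2 := by
  have h1 := h.step_sq
  have h2 := pow_le_pow_left₀ (norm_nonneg _) h.norm_le 2
  have h3 : 0 ≤ a ^ 2 * g ^ 2 := by positivity
  nlinarith [mul_nonneg h.L_nonneg h.pos_Λ.le]

theorem expect_gap_le [NeZero N] (h : Stage1Data P O ν G H L Λ g a n) :
    (𝔼 ω, (P.dual ν - P.dual (P.lamBar O a n ω))) ≤ gapConst G L Λ / √((n : ℝ) + 1) := by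
  have hL := h.L_nonneg
  have hΛ := h.pos_Λ
  have hg := h.pos_g
  refine (expect_dual_gap_le h.pos_a hg.le (by positivity) h.oracle h.subgrad_le h.maximizer n
    h.radius_le).trans ?_
  have hT : (1 : ℝ) ≤ √((n : ℝ) + 1) :=
    Real.one_le_sqrt.2 (by linarith [(Nat.cast_nonneg n : (0 : ℝ) ≤ n)])
  have hTT : √((n : ℝ) + 1) * √((n : ℝ) + 1) = (n : ℝ) + 1 := Real.mul_self_sqrt (by positivity)
  rw [h.step]
  set q := √((n : ℝ) + 1)
  rw [← hTT]
  have hq : 0 < q := by linarith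
  have h1 : ((L + Λ) ^ 2 / (2 * (Λ / (g * q))) + (L + Λ) * g) / (q * q) =
      (g * ((L + Λ) ^ 2 / (2 * Λ)) + g * (L + Λ) / q) / q := by
    field_simp
  rw [h1, gapConst, mul_add G]
  refine div_le_div_of_nonneg_right (add_le_add ?_ ?_) hq.le
  · gcongr
    exact h.g_le
  · rw [div_le_iff₀ hq]
    calc g * (L + Λ) ≤ G * (L + Λ) := by gcongr; exact h.g_le
      _ = G * (L + Λ) * 1 := by ring
      _ ≤ G * (L + Λ) * q := by
        have := h.G_pos
        gcongr

theorem expect_freqDev_le_sqrt [NeZero N] (a : ℝ) {n : ℕ} (hNn : N ≤ n + 1) :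
    (𝔼 ω, P.freqDev O a n ω) ≤ 2 * √(N / ((n : ℝ) + 1)) := by
  refine (expect_freqDev_le a n).trans ?_
  have hT : (0 : ℝ) < (n : ℝ) + 1 := by positivity
  have hNn' : (N : ℝ) ≤ n + 1 := by exact_mod_cast hNn
  have h1 : √(N / ((n : ℝ) + 1)) * ((n : ℝ) + 1) = √(N * ((n : ℝ) + 1)) := by
    rw [← Real.sqrt_sq hT.le, ← Real.sqrt_mul (by positivity), Real.sqrt_sq hT.le]
    congr 1
    field_simp
  rw [div_le_iff₀ hT, mul_assoc, h1, two_mul]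
  gcongr
  · linarith
  · refine Real.le_sqrt_of_sq_le ?_
    rw [sq]
    gcongr

theorem expect_normPos_residual_le [NeZero N] (h : Stage1Data P O ν G H L Λ g a n)
    (hNn : N ≤ n + 1) :
    (𝔼 ω, normPos (P.residual (P.xBar O a n ω))) ≤
      G * ((2 * L + Λ) / Λ + 3) * √(N / ((n : ℝ) + 1)) := by
  have hL := h.L_nonneg
  have hΛ := h.pos_Λ
  have hg := h.pos_g
  have hG := h.G_pos
  have hN1 : (1 : ℝ) ≤ N := by exact_mod_cast NeZero.one_le (n := N)
  have hT : (0 : ℝ) < (n : ℝ) + 1 := by positivity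
  have hNn' : (N : ℝ) ≤ n + 1 := by exact_mod_cast hNn
  set κ := √(N / ((n : ℝ) + 1)) with hκ
  have hκ1 : κ ≤ 1 := Real.sqrt_le_one.2 (div_le_one_of_le₀ hNn' hT.le)
  have hκ0 : 0 ≤ κ := Real.sqrt_nonneg _
  have hκ2 : κ ^ 2 = N / ((n : ℝ) + 1) := Real.sq_sqrt (by positivity)
  have hinv : 1 / √((n : ℝ) + 1) ≤ κ := by
    rw [hκ, ← Real.sqrt_one, ← Real.sqrt_div zero_le_one, Real.sqrt_one]
    gcongr
  have h1 : (𝔼 ω, ‖(P.dualRun O a n ω).lam‖) ≤ 2 * L + Λ := by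
    have h2 : (𝔼 ω, ‖(P.dualRun O a n ω).lam - ν‖) ≤ L + Λ :=
      expect_le_of_expect_sq_le (by positivity)
        ((expect_norm_lam_sub_sq_le h.pos_a.le h.oracle h.subgrad_le h.maximizer n).trans
          h.radius_le)
    calc _ ≤ 𝔼 ω, (‖(P.dualRun O a n ω).lam - ν‖ + L) := by
          refine Finset.expect_le_expect fun ω _ => ?_
          have h3 := norm_add_le ((P.dualRun O a n ω).lam - ν) ν
          rw [sub_add_cancel] at h3
          linarith [h.norm_le]
      _ ≤ _ := by
          rw [Finset.expect_add_distrib, Fintype.expect_const]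
          linarith
  have h2 : 1 / (a * ((n : ℝ) + 1)) = g / Λ * (1 / √((n : ℝ) + 1)) := by
    have hTT : √((n : ℝ) + 1) * √((n : ℝ) + 1) = (n : ℝ) + 1 := Real.mul_self_sqrt hT.le
    have hq : √((n : ℝ) + 1) ≠ 0 := by positivity
    rw [h.step]
    nth_rw 2 [← hTT]
    field_simp
  calc _ ≤ 𝔼 ω, (‖(P.dualRun O a n ω).lam‖ * (1 / (a * ((n : ℝ) + 1))) + N * g / ((n : ℝ) + 1) +
          g * P.freqDev O a n ω) := by
        refine Finset.expect_le_expect fun ω _ => ?_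
        rw [mul_one_div]
        exact normPos_residual_xBar_le h.pos_a h.oracle h.subgrad_le (NeZero.pos N) n ω
    _ = (𝔼 ω, ‖(P.dualRun O a n ω).lam‖) * (g / Λ * (1 / √((n : ℝ) + 1))) + g * κ ^ 2 +
          g * 𝔼 ω, P.freqDev O a n ω := by
        rw [Finset.expect_add_distrib, Finset.expect_add_distrib, Fintype.expect_const,
          ← Finset.expect_mul, ← Finset.mul_expect, h2, hκ2]
        ring
    _ ≤ (2 * L + Λ) * (G / Λ * κ) + G * κ + G * (2 * κ) := by
        have hF := expect_freqDev_le_sqrt (P := P) (O := O) a hNn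
        have hF0 : 0 ≤ 𝔼 ω, P.freqDev O a n ω :=
          Finset.expect_nonneg fun ω _ => Finset.sum_nonneg fun i _ => abs_nonneg _
        have hgG := h.g_le
        have hκκ : κ ^ 2 ≤ κ := by nlinarith
        gcongr
    _ = _ := by ring

theorem neg_le_dual [NeZero N] (h : Stage1Data P O ν G H L Λ g a n) : -H ≤ P.dual ν := by
  refine le_trans ?_ (h.maximizer.2 0 fun j => le_refl _)
  rw [← h.oracle.expect_blockDual]
  refine Finset.le_expect Finset.univ_nonempty fun i _ => ?_
  simpa [blockDual] using (abs_le.1 (h.hval_le i _ (h.oracle.mem i zero_le_one 0))).1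

theorem objective_sub_dual_le [NeZero N] (h : Stage1Data P O ν G H L Λ g a n)
    (ω : Fin n → Fin N) :
    max (P.objective (P.xBar O a n ω) - P.dual (P.lamBar O a n ω)) 0 ≤
      (P.dual ν - P.dual (P.lamBar O a n ω)) + |P.dualDev O a n ω| * (1 / ((n : ℝ) + 1)) +
        a * g ^ 2 / 2 + H * (1 / ((n : ℝ) + 1)) + H * (N / ((n : ℝ) + 1)) +
          H * P.freqDev O a n ω := by
  have ha := h.pos_a
  have hg := h.pos_g
  have hH := h.H_nonneg
  have hT : (0 : ℝ) < (n : ℝ) + 1 := by positivity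
  have hF0 : 0 ≤ P.freqDev O a n ω := Finset.sum_nonneg fun i _ => abs_nonneg _
  have hv : P.dual (P.lamBar O a n ω) ≤ P.dual ν := h.maximizer.2 _ (lamBar_nonneg a n ω)
  refine max_le ?_ ?_
  · have h1 := objective_xBar_le h.oracle h.hval_le a n ω
    set S := P.pathSum O a (fun s i => P.hval i (O i 1 s.lam)) n ω
    have h2 : S ≤ P.dualDev O a n ω + P.dualSum O a n ω + n * (a * g ^ 2 / 2) := by
      have h3 := pathSum_hval_le (a := a) h.oracle h.subgrad_le n ω
      have h4 : 2 * a * S ≤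
          2 * a * (P.dualDev O a n ω + P.dualSum O a n ω + n * (a * g ^ 2 / 2)) := by
        linarith [sq_nonneg ‖(P.dualRun O a n ω).lam‖]
      exact le_of_mul_le_mul_left h4 (by positivity)
    have h3 : S / ((n : ℝ) + 1) ≤ |P.dualDev O a n ω| * (1 / ((n : ℝ) + 1)) + P.dual ν +
        H * (1 / ((n : ℝ) + 1)) + a * g ^ 2 / 2 := by
      rw [div_le_iff₀ hT]
      have h4 := dualSum_le (O := O) h.maximizer a n ω
      have h5 := le_abs_self (P.dualDev O a n ω)
      have h6 := h.neg_le_dual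
      have h7 : 0 ≤ a * g ^ 2 / 2 := by positivity
      have h8 : 1 / ((n : ℝ) + 1) * ((n : ℝ) + 1) = 1 := one_div_mul_cancel hT.ne'
      have h9 : (|P.dualDev O a n ω| * (1 / ((n : ℝ) + 1)) + P.dual ν +
          H * (1 / ((n : ℝ) + 1)) + a * g ^ 2 / 2) * ((n : ℝ) + 1) =
          |P.dualDev O a n ω| + (n + 1) * P.dual ν + H + (n + 1) * (a * g ^ 2 / 2) := by
        linear_combination (|P.dualDev O a n ω| + H) * h8
      rw [h9]
      linarith
    have h4 : N * H / ((n : ℝ) + 1) = H * (N / ((n : ℝ) + 1)) := by ring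
    linarith
  · have : 0 ≤ P.dual ν - P.dual (P.lamBar O a n ω) := sub_nonneg.2 hv
    positivity

theorem expect_objective_sub_dual_le [NeZero N] (h : Stage1Data P O ν G H L Λ g a n)
    (hNn : N ≤ n + 1) :
    (𝔼 ω, max (P.objective (P.xBar O a n ω) - P.dual (P.lamBar O a n ω)) 0) ≤
      (gapConst G L Λ + (2 * H + 4 * G * L + 2 * G * Λ) + G * Λ / 2 + 4 * H) *
        √(N / ((n : ℝ) + 1)) := by
  have hL := h.L_nonneg
  have hΛ := h.pos_Λ
  have hg := h.pos_g
  have hG := h.G_pos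
  have hH := h.H_nonneg
  have hN1 : (1 : ℝ) ≤ N := by exact_mod_cast NeZero.one_le (n := N)
  have hT : (0 : ℝ) < (n : ℝ) + 1 := by positivity
  have hNn' : (N : ℝ) ≤ n + 1 := by exact_mod_cast hNn
  set κ := √(N / ((n : ℝ) + 1)) with hκ
  have hκ1 : κ ≤ 1 := Real.sqrt_le_one.2 (div_le_one_of_le₀ hNn' hT.le)
  have hκ0 : 0 ≤ κ := Real.sqrt_nonneg _
  have hκ2 : κ ^ 2 = N / ((n : ℝ) + 1) := Real.sq_sqrt (by positivity)
  have hκκ : N / ((n : ℝ) + 1) ≤ κ := by rw [← hκ2]; nlinarith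
  have hinv : 1 / √((n : ℝ) + 1) ≤ κ := by
    rw [hκ, ← Real.sqrt_one, ← Real.sqrt_div zero_le_one, Real.sqrt_one]
    gcongr
  have hinv2 : 1 / ((n : ℝ) + 1) ≤ κ := le_trans (by gcongr) hκκ
  have hTT : √((n : ℝ) + 1) * √((n : ℝ) + 1) = (n : ℝ) + 1 := Real.mul_self_sqrt hT.le
  set D := 2 * H + 4 * G * L + 2 * G * Λ with hD
  have hD0 : 0 ≤ D := by positivity
  have hdev : (𝔼 ω, |P.dualDev O a n ω|) ≤ √((n : ℝ) + 1) * D := by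
    refine expect_le_of_expect_sq_le (by positivity) ?_
    simp only [sq_abs]
    refine (expect_dualDev_sq_le h.pos_a.le h.oracle h.subgrad_le h.hval_le h.maximizer n).trans ?_
    rw [mul_pow, Real.sq_sqrt hT.le]
    have h1 : ‖ν‖ ^ 2 ≤ L ^ 2 := pow_le_pow_left₀ (norm_nonneg _) h.norm_le 2
    have h2 : g ^ 2 ≤ G ^ 2 := pow_le_pow_left₀ hg.le h.g_le 2
    have h3 : n * (a ^ 2 * g ^ 2) ≤ Λ ^ 2 := by
      rw [← h.step_sq]
      gcongr
      linarith
    have h4 : 2 * H ^ 2 + 2 * g ^ 2 * (4 * ‖ν‖ ^ 2 + 2 * n * (a ^ 2 * g ^ 2)) ≤ D ^ 2 := by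
      calc _ = 2 * H ^ 2 + 2 * g ^ 2 * (4 * ‖ν‖ ^ 2 + 2 * (n * (a ^ 2 * g ^ 2))) := by ring
        _ ≤ 2 * H ^ 2 + 2 * G ^ 2 * (4 * L ^ 2 + 2 * Λ ^ 2) := by gcongr
        _ ≤ D ^ 2 := by
          have e : D ^ 2 = 2 * H ^ 2 + 2 * G ^ 2 * (4 * L ^ 2 + 2 * Λ ^ 2) +
              (2 * H ^ 2 + 8 * G ^ 2 * L ^ 2 + 16 * H * G * L + 8 * H * G * Λ +
                16 * G ^ 2 * L * Λ) := by
            rw [hD]; ring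
          have : 0 ≤ 2 * H ^ 2 + 8 * G ^ 2 * L ^ 2 + 16 * H * G * L + 8 * H * G * Λ +
              16 * G ^ 2 * L * Λ := by positivity
          linarith
    gcongr
    linarith
  have hag : a * g ^ 2 / 2 ≤ G * Λ / 2 * κ := by
    have h1 : a * g ^ 2 / 2 = g * Λ / 2 * (1 / √((n : ℝ) + 1)) := by
      have hq : √((n : ℝ) + 1) ≠ 0 := by positivity
      rw [h.step]
      field_simp
    rw [h1]
    have := h.g_le
    gcongr
  have hdevT : (𝔼 ω, |P.dualDev O a n ω|) * (1 / ((n : ℝ) + 1)) ≤ D * κ := by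
    calc _ ≤ √((n : ℝ) + 1) * D * (1 / ((n : ℝ) + 1)) := by gcongr
      _ = D * (1 / √((n : ℝ) + 1)) := by
        have hq : √((n : ℝ) + 1) ≠ 0 := by positivity
        nth_rw 2 [← hTT]
        field_simp
      _ ≤ _ := by gcongr
  have hgap : (𝔼 ω, (P.dual ν - P.dual (P.lamBar O a n ω))) ≤ gapConst G L Λ * κ := by
    refine h.expect_gap_le.trans ?_
    have : 0 ≤ gapConst G L Λ := by unfold gapConst; positivity
    rw [← mul_one_div]
    gcongr
  have hF := expect_freqDev_le_sqrt (P := P) (O := O) a hNn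
  have h1 := Finset.expect_le_expect (s := Finset.univ) fun ω _ => h.objective_sub_dual_le ω
  refine h1.trans ?_
  rw [Finset.expect_add_distrib, Finset.expect_add_distrib, Finset.expect_add_distrib,
    Finset.expect_add_distrib, Finset.expect_add_distrib, Fintype.expect_const,
    Fintype.expect_const, Fintype.expect_const, ← Finset.expect_mul, ← Finset.mul_expect]
  have e1 := mul_le_mul_of_nonneg_left hinv2 hH
  have e2 := mul_le_mul_of_nonneg_left hκκ hH
  have e3 := mul_le_mul_of_nonneg_left hF hH
  linarith

/-- The initial potential of the second stage. -/
theorem expect_sqrt_potential_le [NeZero N] (h : Stage1Data P O ν G H L Λ g a n)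
    (hNn : N ≤ n + 1) (ρ : ℕ → ℝ) :
    (𝔼 ω, √(potential (P.dual (P.lamBar O a n ω))
      (P.run2 O (P.dual (P.lamBar O a n ω)) (P.xBar O a n ω) ρ 0 Fin.elim0))) ≤
      startConst G H L Λ * √(N / ((n : ℝ) + 1)) := by
  calc _ ≤ 𝔼 ω, (max (P.objective (P.xBar O a n ω) - P.dual (P.lamBar O a n ω)) 0 +
        normPos (P.residual (P.xBar O a n ω))) := by
        refine Finset.expect_le_expect fun ω _ => ?_
        have h1 : potential (P.dual (P.lamBar O a n ω))
            (P.run2 O (P.dual (P.lamBar O a n ω)) (P.xBar O a n ω) ρ 0 Fin.elim0) =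
            max (P.objective (P.xBar O a n ω) - P.dual (P.lamBar O a n ω)) 0 ^ 2 +
              normPos (P.residual (P.xBar O a n ω)) ^ 2 := by
          rw [normPos_eq_norm_projPos, potential, objective, residual, Finset.mul_sum,
            Finset.smul_sum]
          rfl
        have h2 : 0 ≤ max (P.objective (P.xBar O a n ω) - P.dual (P.lamBar O a n ω)) 0 :=
          le_max_right _ _
        have h3 := normPos_nonneg (P.residual (P.xBar O a n ω))
        rw [h1]
        refine Real.sqrt_le_iff.2 ⟨by positivity, ?_⟩
        nlinarith [mul_nonneg h2 h3]
    _ ≤ _ := by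
        rw [Finset.expect_add_distrib]
        have h1 := h.expect_objective_sub_dual_le hNn
        have h2 := h.expect_normPos_residual_le hNn
        unfold startConst
        linarith

end Stage1Data

/-! ### The two-stage algorithm -/

variable (P) in
/-- The final state of the second stage, when the first stage uses the constant step size `a`. -/
noncomputable def finalState (O : P.Oracle) (a : ℝ) (n K : ℕ)
    (ω : (Fin n → Fin N) × (Fin K → Fin N)) : P.State2 :=
  P.run2 O (P.dual (P.lamBar O a n ω.1)) (P.xBar O a n ω.1) (fwStep N) K ω.2

theorem Stage1Data.expect_sqrt_potential_finalState_le [NeZero N] {ν : Vec m}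
    {G H L Λ g a : ℝ} {n : ℕ} (h : Stage1Data P O ν G H L Λ g a n)
    (hval : P.IsPrimalValue (P.dual ν)) (hNn : N ≤ n + 1) :
    (𝔼 ω, √(potential (P.dual (P.lamBar O a n ω.1)) (P.finalState O a n (n + 1) ω))) ≤
      (gapConst G L Λ + 4 * (H + G)) * (1 / √((n : ℝ) + 1)) +
        2 * startConst G H L Λ * (N / ((n : ℝ) + 1) * √(N / ((n : ℝ) + 1))) := by
  have hHG : 0 ≤ H + G := add_nonneg h.H_nonneg h.G_pos.le
  have hG : ∀ i, ∀ x ∈ P.X i, ‖P.mulA i x - P.b‖ ≤ G := fun i x hx =>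
    (h.subgrad_le i x hx).trans h.g_le
  have hfeas : ∀ v, ∀ δ > 0, ∃ y, P.Feasible y ∧ P.objective y - v ≤ (P.dual ν - v) + δ := by
    intro v δ hδ
    obtain ⟨r, ⟨y, hy, rfl⟩, -, hr⟩ := hval.exists_between (lt_add_of_pos_right (P.dual ν) hδ)
    exact ⟨y, hy, by linarith⟩
  rw [← Finset.univ_product_univ, Finset.expect_product]
  calc _ ≤ 𝔼 ω, ((P.dual ν - P.dual (P.lamBar O a n ω)) + 2 * N / ((n : ℝ) + 1) *
        √(potential (P.dual (P.lamBar O a n ω)) (P.run2 O (P.dual (P.lamBar O a n ω))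
          (P.xBar O a n ω) (fwStep N) 0 Fin.elim0)) + 4 * (H + G) / √((n : ℝ) + 1)) := by
        refine Finset.expect_le_expect fun ω _ => ?_
        have h1 := expect_sqrt_potential_run2_le h.oracle h.hval_le hG
          (xBar_mem h.oracle a n ω)
          (sub_nonneg.2 (h.maximizer.2 _ (lamBar_nonneg (O := O) a n ω))) hHG (hfeas _)
          (Nat.le_add_left 1 n)
        push_cast at h1
        exact h1
    _ = (𝔼 ω, (P.dual ν - P.dual (P.lamBar O a n ω))) + 2 * N / ((n : ℝ) + 1) *
        (𝔼 ω, √(potential (P.dual (P.lamBar O a n ω)) (P.run2 O (P.dual (P.lamBar O a n ω))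
          (P.xBar O a n ω) (fwStep N) 0 Fin.elim0))) + 4 * (H + G) / √((n : ℝ) + 1) := by
        rw [Finset.expect_add_distrib, Finset.expect_add_distrib, Fintype.expect_const,
          ← Finset.mul_expect]
    _ ≤ gapConst G L Λ / √((n : ℝ) + 1) + 2 * N / ((n : ℝ) + 1) *
        (startConst G H L Λ * √(N / ((n : ℝ) + 1))) + 4 * (H + G) / √((n : ℝ) + 1) := by
        gcongr
        · exact h.expect_gap_le
        · exact h.expect_sqrt_potential_le hNn _
    _ = _ := by ring

theorem objective_le_of_valid2 {H v : ℝ} {s : P.State2} (hs : Valid2 H s) :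
    P.objective s.xHat ≤ v + √(potential v s) := by
  have h1 : P.objective s.xHat ≤ ∑ i, s.β i := by
    rw [objective, Finset.mul_sum]
    exact Finset.sum_le_sum fun i _ => hs.hval_le i
  have h2 : max (∑ i, s.β i - v) 0 ≤ √(potential v s) :=
    Real.le_sqrt_of_sq_le (le_add_of_nonneg_right (sq_nonneg _))
  linarith [le_max_left (∑ i, s.β i - v) 0]

theorem normPos_residual_le_of_valid2 {H v : ℝ} {s : P.State2} (hs : Valid2 H s) :
    normPos (P.residual s.xHat) ≤ √(potential v s) := by
  have h1 : P.residual s.xHat = ∑ i, s.z i - P.b := by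
    rw [residual, Finset.smul_sum]
    simp only [hs.z_eq]
  rw [h1, normPos_eq_norm_projPos]
  exact Real.le_sqrt_of_sq_le (le_add_of_nonneg_left (sq_nonneg _))

theorem exists_stage1Data {ν : Vec m} {G H L Λ : ℝ} (hO : P.IsArgminOracle O)
    (hν : P.IsDualMaximizer ν) (hL : ‖ν‖ ≤ L) (hG : P.Gtilde ≤ G) (hG1 : 1 ≤ G)
    (hH : ∀ i, ∀ x ∈ P.X i, |P.hval i x| ≤ H) (hH0 : 0 ≤ H) (hΛ : 0 < Λ) (n : ℕ) :
    ∃ g a, Stage1Data P O ν G H L Λ g a n ∧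
      ∀ ω, P.stage1 O 0 (fun _ => Λ / (P.Gtilde * √((n + 1 : ℕ) : ℝ))) (n + 1) ω =
        P.stage1 O 0 (fun _ => a) (n + 1) ω := by
  rcases lt_or_ge 0 P.Gtilde with h | h
  · refine ⟨P.Gtilde, Λ / (P.Gtilde * √((n : ℝ) + 1)), ⟨hO, hν, hL, fun i x hx =>
      P.norm_mulA_sub_le_Gtilde i hx, hH, hΛ, h, hG, hH0, rfl⟩, fun ω => ?_⟩
    push_cast
    rfl
  · -- If `G̃ = 0`, all stochastic subgradients vanish, and `g = 1` is an admissible bound.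
    have h0 : ∀ i, ∀ x ∈ P.X i, P.mulA i x - P.b = 0 := fun i x hx =>
      norm_le_zero_iff.1 ((P.norm_mulA_sub_le_Gtilde i hx).trans h)
    refine ⟨1, Λ / (1 * √((n : ℝ) + 1)), ⟨hO, hν, hL, fun i x hx => ?_, hH, hΛ, one_pos, hG1,
      hH0, rfl⟩, fun ω => ?_⟩
    · rw [h0 i x hx, norm_zero]
      exact zero_le_one
    · have := run1_eq_of_subgrad_eq_zero hO h0 (Λ / (P.Gtilde * √((n + 1 : ℕ) : ℝ)))
        (Λ / (1 * √((n : ℝ) + 1))) n ω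
      simp only [stage1]
      exact congrArg (fun s : P.State1 => (⟨(1 / ((n + 1 : ℕ) : ℝ)) • (s.lamSum + s.lam),
        fun i => (1 / ((s.count i : ℝ) + 1)) • (s.xSum i + O i 1 s.lam), s.calls + N⟩ :
          P.Output1)) this

theorem calls_standardTwoStage (Λ : ℝ) (T K : ℕ) (ω : Samples N T K) :
    (P.standardTwoStage O Λ T K ω).calls = (T - 1) + N + N + K := by
  simp only [standardTwoStage, twoStage, stage1, calls_run1, calls_run2]

/-- The accuracy of the two-stage algorithm with `T = K = n + 1`. -/
theorem accurateInExpectation_standardTwoStage [NeZero N] {ν : Vec m} {G H L Λ ε : ℝ}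
    (hO : P.IsArgminOracle O) (hν : P.IsDualMaximizer ν) (hval : P.IsPrimalValue (P.dual ν))
    (hL : ‖ν‖ ≤ L) (hG : P.Gtilde ≤ G) (hG1 : 1 ≤ G)
    (hH : ∀ i, ∀ x ∈ P.X i, |P.hval i x| ≤ H) (hH0 : 0 ≤ H) (hΛ : 0 < Λ) (n : ℕ)
    (hNn : N ≤ n + 1)
    (hε : (gapConst G L Λ + 4 * (H + G)) * (1 / √((n : ℝ) + 1)) +
      2 * startConst G H L Λ * (N / ((n : ℝ) + 1) * √(N / ((n : ℝ) + 1))) ≤ ε) :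
    P.AccurateInExpectation (P.dual ν) ε
      (fun ω => (P.standardTwoStage O Λ (n + 1) (n + 1) ω).xHat) := by
  obtain ⟨g, a, h, heq⟩ := exists_stage1Data hO hν hL hG hG1 hH hH0 hΛ n
  have hx : ∀ ω : Samples N (n + 1) (n + 1), (P.standardTwoStage O Λ (n + 1) (n + 1) ω).xHat =
      (P.finalState O a n (n + 1) ω).xHat := by
    intro ω
    simp only [standardTwoStage, twoStage]
    rw [heq, stage1_eq]
    rfl
  have hvalid : ∀ ω, Valid2 H (P.finalState O a n (n + 1) ω) := fun ω =>
    valid2_run2 hO hH (fwStep_nonneg N) (fwStep_le_one N) (xBar_mem hO a n ω.1) _ _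
  have key := (h.expect_sqrt_potential_finalState_le hval hNn).trans hε
  simp only [hx]
  refine ⟨fun ω i => (hvalid ω).mem i, ?_, ?_⟩
  · calc _ ≤ 𝔼 ω : Samples N (n + 1) (n + 1), (P.dual ν +
          √(potential (P.dual (P.lamBar O a n ω.1)) (P.finalState O a n (n + 1) ω))) := by
          refine Finset.expect_le_expect fun ω _ => ?_
          refine (objective_le_of_valid2 (v := P.dual (P.lamBar O a n ω.1)) (hvalid ω)).trans ?_
          gcongr
          exact hν.2 _ (lamBar_nonneg a n ω.1)
      _ ≤ _ := by
          rw [Finset.expect_add_distrib, Fintype.expect_const]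
          gcongr
          exact key
  · refine le_trans (Finset.expect_le_expect fun ω _ => ?_) key
    exact normPos_residual_le_of_valid2 (hvalid ω)

/-! ### Choice of the number of iterations -/

theorem mul_one_div_sqrt_le {c ε A T : ℝ} (hc : 0 < c) (hε : 0 < ε) (hA : 4 * c ^ 2 ≤ A)
    (hT : A * (1 / ε ^ 2) ≤ T) : c * (1 / √T) ≤ ε / 2 := by
  have h1 : 2 * c / ε ≤ √T := by
    refine Real.le_sqrt_of_sq_le (le_trans ?_ hT)
    calc (2 * c / ε) ^ 2 = 4 * c ^ 2 * (1 / ε ^ 2) := by ring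
      _ ≤ _ := by gcongr
  have h2 : 0 < √T := lt_of_lt_of_le (by positivity) h1
  rw [mul_one_div, div_le_iff₀ h2]
  rw [div_le_iff₀ hε] at h1
  linarith

theorem rpow_two_thirds_cubed {x : ℝ} (hx : 0 ≤ x) : (x ^ (2 / 3 : ℝ)) ^ 3 = x ^ 2 := by
  rw [← Real.rpow_natCast, ← Real.rpow_mul hx, ← Real.rpow_natCast]
  norm_num

theorem mul_mul_sqrt_le {c ε A M T : ℝ} (hc : 0 < c) (hε : 0 < ε) (hM : 0 ≤ M) (hT0 : 0 < T)
    (hA : (4 * c) ^ (2 / 3 : ℝ) ≤ A) (hT : A * (M / ε ^ (2 / 3 : ℝ)) ≤ T) :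
    2 * c * (M / T * √(M / T)) ≤ ε / 2 := by
  have hp0 : 0 < (4 * c) ^ (2 / 3 : ℝ) := by positivity
  have he0 : 0 < ε ^ (2 / 3 : ℝ) := by positivity
  have hp3 := rpow_two_thirds_cubed (by positivity : 0 ≤ 4 * c)
  have he3 := rpow_two_thirds_cubed hε.le
  set p := (4 * c) ^ (2 / 3 : ℝ)
  set e := ε ^ (2 / 3 : ℝ)
  set u := M / T with hu
  have hu0 : 0 ≤ u := by positivity
  have h1 : u * p ≤ e := by
    have h2 : p * (M / e) ≤ T := le_trans (by gcongr) hT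
    rw [mul_div_assoc', div_le_iff₀ he0] at h2
    rw [hu, div_mul_eq_mul_div, div_le_iff₀ hT0]
    linarith
  have h2 : (4 * c * (u * √u)) ^ 2 ≤ ε ^ 2 := by
    calc (4 * c * (u * √u)) ^ 2 = (4 * c) ^ 2 * u ^ 2 * √u ^ 2 := by ring
      _ = (u * p) ^ 3 := by rw [Real.sq_sqrt hu0, ← hp3]; ring
      _ ≤ e ^ 3 := by gcongr
      _ = ε ^ 2 := he3
  have h3 := abs_le_of_sq_le_sq h2 hε.le
  linarith [(abs_le.1 h3).2]

end SeparableProblem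

theorem mainTheorem1 (Λ : ℝ) (hΛ : 0 < Λ) (G H L ε₀ : ℝ) (hε₀ : 0 < ε₀) :
    ∃ C : ℝ, 0 < C ∧ ∀ N : ℕ, 0 < N → ∀ ε : ℝ, 0 < ε → ε ≤ ε₀ →
      ∃ T₀ : ℕ, 1 ≤ T₀ ∧
        ∀ (m : ℕ) (P : SeparableProblem N m) (O : P.Oracle) (lamStar : Vec m),
          P.IsArgminOracle O →
          P.IsDualMaximizer lamStar →
          P.IsPrimalValue (P.dual lamStar) →
          ‖lamStar‖ ≤ L →
          P.Gtilde ≤ G →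
          (∀ i, ∀ x ∈ P.X i, |P.hval i x| ≤ H) →
          (∀ T : ℕ, T₀ ≤ T →
            P.AccurateInExpectation (P.dual lamStar) ε
              (fun ω => (P.standardTwoStage O Λ T T ω).xHat)) ∧
          (∀ ω : SeparableProblem.Samples N T₀ T₀,
            ((P.standardTwoStage O Λ T₀ T₀ ω).calls : ℝ)
              ≤ C * (1 / ε ^ 2 + (N : ℝ) / ε ^ (2 / 3 : ℝ))) := by
  -- `G`, `H` and `L` may be any real numbers, but `C` has to be positive. Moreover `1 ≤ G'` leaves
  -- room for a positive bound of the subgradients in the case `G̃ = 0`.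
  set G' := max G 1 with hG'
  set H' := |H|
  set L' := |L|
  have hG1 : 1 ≤ G' := le_max_right _ _
  have hG0 : 0 < G' := by linarith
  have hH0 : 0 ≤ H' := abs_nonneg _
  have hL0 : 0 ≤ L' := abs_nonneg _
  set c₁ := SeparableProblem.gapConst G' L' Λ + 4 * (H' + G') with hc₁
  set c₂ := SeparableProblem.startConst G' H' L' Λ with hc₂
  have hc₁0 : 0 < c₁ := by
    rw [hc₁, SeparableProblem.gapConst]
    positivity
  have hc₂0 : 0 < c₂ := by
    rw [hc₂, SeparableProblem.startConst, SeparableProblem.gapConst]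
    positivity
  -- The first two summands make the two terms of the accuracy at most `ε / 2` each, and the third
  -- one ensures `N ≤ T`.
  set A := 4 * c₁ ^ 2 + (4 * c₂) ^ (2 / 3 : ℝ) + ε₀ ^ (2 / 3 : ℝ) with hA
  have hp0 : 0 < (4 * c₂) ^ (2 / 3 : ℝ) := by positivity
  have he₀0 : 0 < ε₀ ^ (2 / 3 : ℝ) := by positivity
  have hA0 : 0 < A := by positivity
  refine ⟨2 * A + 3 * ε₀ ^ (2 / 3 : ℝ), by positivity, fun N hN ε hε hεε₀ => ?_⟩
  have : NeZero N := ⟨hN.ne'⟩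
  have hN1 : (1 : ℝ) ≤ N := by exact_mod_cast hN
  have he0 : 0 < ε ^ (2 / 3 : ℝ) := by positivity
  have hee₀ : ε ^ (2 / 3 : ℝ) ≤ ε₀ ^ (2 / 3 : ℝ) := by gcongr
  set x := 1 / ε ^ 2 + (N : ℝ) / ε ^ (2 / 3 : ℝ) with hx
  have hx1 : 1 / ε ^ 2 ≤ x := le_add_of_nonneg_right (by positivity)
  have hx2 : (N : ℝ) / ε ^ (2 / 3 : ℝ) ≤ x := le_add_of_nonneg_left (by positivity)
  have hx0 : 0 < x := by positivity
  have hNx : (N : ℝ) ≤ ε₀ ^ (2 / 3 : ℝ) * x := by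
    calc (N : ℝ) = ε ^ (2 / 3 : ℝ) * (N / ε ^ (2 / 3 : ℝ)) := by field_simp
      _ ≤ _ := by gcongr
  have hT₀ : 1 ≤ ⌈A * x⌉₊ := Nat.one_le_iff_ne_zero.2 (Nat.ceil_pos.2 (by positivity)).ne'
  refine ⟨⌈A * x⌉₊, hT₀, fun m P O lamStar hO hν hval hL hG hH => ⟨fun T hT => ?_, fun ω => ?_⟩⟩
  · have hTx : A * x ≤ T := Nat.ceil_le.1 hT
    obtain ⟨n, rfl⟩ : ∃ n, T = n + 1 := ⟨T - 1, by omega⟩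
    push_cast at hTx
    have hTpos : (0 : ℝ) < (n : ℝ) + 1 := by positivity
    have hNn : (N : ℝ) ≤ ((n + 1 : ℕ) : ℝ) := by
      push_cast
      refine hNx.trans (le_trans ?_ hTx)
      gcongr
      rw [hA]
      exact le_add_of_nonneg_left (by positivity)
    refine SeparableProblem.accurateInExpectation_standardTwoStage hO hν hval
      (hL.trans (le_abs_self L)) (hG.trans (le_max_left G 1)) hG1
      (fun i y hy => (hH i y hy).trans (le_abs_self H)) hH0 hΛ n
      (by exact_mod_cast hNn) ?_
    have h1 : c₁ * (1 / √((n : ℝ) + 1)) ≤ ε / 2 :=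
      SeparableProblem.mul_one_div_sqrt_le (A := A) hc₁0 hε (by rw [hA]; linarith)
        (le_trans (by gcongr) hTx)
    have h2 : 2 * c₂ * (N / ((n : ℝ) + 1) * √(N / ((n : ℝ) + 1))) ≤ ε / 2 :=
      SeparableProblem.mul_mul_sqrt_le (A := A) hc₂0 hε (by positivity) hTpos
        (by rw [hA]; nlinarith [sq_nonneg c₁]) (le_trans (by gcongr) hTx)
    linarith
  · rw [SeparableProblem.calls_standardTwoStage]
    have h1 : (⌈A * x⌉₊ : ℝ) < A * x + 1 := Nat.ceil_lt_add_one (by positivity)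
    push_cast [Nat.cast_sub hT₀]
    linarith
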